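/- Use English notation (rows numbered from top to bottom). For partitions $\mu\subseteq\lambda$, a standard skew tableau $S$ of shape $\lambda/\mu$ with $m=|\lambda|-|\mu|$ cells is a filling of the cells of $\lambda/\mu$ by $1,\dots,m$, each used exactly once, whose rows and columns increase. Let $\mathrm{Rect}$ denote rectification, i.e. performing jeu de taquin inner slides until the shape is straight. Assume that the row sizes $\lambda_i-\mu_i$ weakly decrease from top to bottom. For $k\ge 1$ let $S^{(k)}$ be the standard skew tableau obtained from $S$ by attaching on its right, row by row, the $k-1$ shifted copies $S+m,\ S+2m,\ \dots,\ S+(k-1)m$. The tableau $S$ stabilizes at $k\ge 1$ if every entry in $[(k-1)m+1,\,km]$ lies in the same row in $\mathrm{Rect}(S^{(k)})$ and in $S^{(k)}$; $\mathrm{stab}(S)$ is the least $k\ge1$ at which $S$ stabilizes. Two standard skew tableaux of shape $\lambda/\mu$ are dual equivalent if they differ by a finite sequence of elementary dual equivalence moves $d_i$, where $d_i$ swaps the entries $i$ and $i\pm1$ if $i\mp1$ lies between them in reading order (rows from bottom to top, each row from left to right). Theorem. Let $\mu\subseteq\lambda$ be partitions such that the row sizes of $\lambda/\mu$ weakly decrease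 from top to bottom. If $S$ and $T$ are dual equivalent standard skew tableaux of shape $\lambda/\mu$, then $S$ and $T$ both stabilize at some positive integer, so that $\mathrm{stab}(S)$ and $\mathrm{stab}(T)$ are defined, and $\mathrm{stab}(S)=\mathrm{stab}(T)$. -/

import Mathlib

/-!
Cells are pairs `(i, j)` of row index and column index, both counted from `0`, rows numbered from
top to bottom (English notation).  A filling is a function `ℕ × ℕ → ℕ`; the value `0` marks an
empty cell, and all actual entries are positive.
-/

/-- The cells of the skew shape `lam / mu`. -/
def skewCells (lam mu : YoungDiagram) : Finset (ℕ × ℕ) :=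
  lam.cells \ mu.cells

/-- A standard skew tableau of shape `lam / mu`: a filling of the cells of `lam / mu`, weakly
increasing along rows and strictly increasing down columns, that uses each of
`1, …, |lam / mu|` exactly once. -/
structure StandardSkewTableau (lam mu : YoungDiagram) where
  entry : ℕ × ℕ → ℕ
  zeros : ∀ c, c ∉ skewCells lam mu → entry c = 0
  row_weak : ∀ i j₁ j₂, (i, j₁) ∈ skewCells lam mu → (i, j₂) ∈ skewCells lam mu →
    j₁ < j₂ → entry (i, j₁) ≤ entry (i, j₂)
  col_strict : ∀ i₁ i₂ j, (i₁, j) ∈ skewCells lam mu → (i₂, j) ∈ skewCells lam mu →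
    i₁ < i₂ → entry (i₁, j) < entry (i₂, j)
  standard : Set.BijOn entry (skewCells lam mu : Set (ℕ × ℕ))
    (Set.Icc 1 (skewCells lam mu).card)

/-- The number of cells of `lam / mu` in row `i`, where `mu ≤ lam`: the row vector. -/
def rowSize (lam mu : YoungDiagram) (i : ℕ) : ℕ :=
  lam.rowLen i - mu.rowLen i

/-- Sliding into the hole `(i, j)` of the filling `f`.  The smaller of the entries to the right of
and below the hole moves into the hole (the lower one in case of a tie), its old cell becomes the
hole, and so on until there is no entry to the right of or below the hole.  The first argument is
the maximal number of steps; every step moves a different entry, so that the number of cells of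
the tableau is always enough. -/
def slide : ℕ → (ℕ × ℕ → ℕ) → ℕ × ℕ → (ℕ × ℕ → ℕ)
  | 0, f, _ => f
  | n + 1, f, (i, j) =>
    if f (i, j + 1) ≠ 0 ∧ (f (i + 1, j) = 0 ∨ f (i, j + 1) < f (i + 1, j)) then
      slide n (Function.update (Function.update f (i, j) (f (i, j + 1))) (i, j + 1) 0) (i, j + 1)
    else if f (i + 1, j) ≠ 0 then
      slide n (Function.update (Function.update f (i, j) (f (i + 1, j))) (i + 1, j) 0) (i + 1, j)
    else f

/-- The cells of `mu`, bottom row first and each row from right to left.  When the cells are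
removed from `mu` in this order, each is an outer corner of what is left of `mu`. -/
def slideStarts (mu : YoungDiagram) : List (ℕ × ℕ) :=
  (List.range (mu.colLen 0)).reverse.flatMap fun i =>
    (List.range (mu.rowLen i)).reverse.map fun j => (i, j)

/-- The rectification of a skew tableau `f` with inner shape `mu` and `n` cells: perform inner
slides, each into an outer corner of the current inner shape, until the shape is straight.  (The
outcome does not depend on the order of the slides; here the lowest corner is always taken.) -/
def rectify (mu : YoungDiagram) (n : ℕ) (f : ℕ × ℕ → ℕ) : ℕ × ℕ → ℕ :=
  (slideStarts mu).foldl (slide n) f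

/-- The filling `f^(k)` made of the filling `f` of `lam / mu` and of `k - 1` shifted copies of it
that are attached to its right: with `m` the number of cells and `r` the number of cells in row
`i`, row `i` of `f^(k)` starts where row `i` of `f` starts and consists of the entries in row `i`
of `f`, then those of `f + m`, then those of `f + 2m`, …, then those of `f + (k - 1)m`. -/
def attachCopies (lam mu : YoungDiagram) (f : ℕ × ℕ → ℕ) (k : ℕ) : ℕ × ℕ → ℕ := fun c =>
  if mu.rowLen c.1 ≤ c.2 ∧ c.2 < mu.rowLen c.1 + k * rowSize lam mu c.1 then
    f (c.1, mu.rowLen c.1 + (c.2 - mu.rowLen c.1) % rowSize lam mu c.1)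
      + (c.2 - mu.rowLen c.1) / rowSize lam mu c.1 * (skewCells lam mu).card
  else 0

/-- `x` is an entry in row `i` of the filling `f`. -/
def InRow (f : ℕ × ℕ → ℕ) (x i : ℕ) : Prop :=
  ∃ j, f (i, j) = x

/-- Cell `c` comes strictly before cell `d` in reading order: rows from bottom to top, each row
from left to right. -/
def ReadsBefore (c d : ℕ × ℕ) : Prop :=
  d.1 < c.1 ∨ (c.1 = d.1 ∧ c.2 < d.2)

namespace StandardSkewTableau

variable {lam mu : YoungDiagram}

/-- `S` stabilizes at the positive integer `k`: the entries in `[(k - 1)m + 1, km]`, where `m` is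
the size of `S`, lie in the same rows in `Rect(S^(k))` and in `S^(k)`. -/
def StabilizesAt (S : StandardSkewTableau lam mu) (k : ℕ) : Prop :=
  1 ≤ k ∧ ∀ x ∈ Set.Icc ((k - 1) * (skewCells lam mu).card + 1) (k * (skewCells lam mu).card),
    ∀ i, InRow (rectify mu (k * (skewCells lam mu).card) (attachCopies lam mu S.entry k)) x i ↔
      InRow (attachCopies lam mu S.entry k) x i

/-- The least positive integer at which `S` stabilizes. -/
noncomputable def stab (S : StandardSkewTableau lam mu) : ℕ :=
  sInf {k | S.StabilizesAt k}

/-- `T` results from `S` by the elementary dual equivalence move `d_i`: for `{a, b} = {i - 1, i + 1}`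
such that `b` lies strictly between `a` and `i` in the reading order of `S`, the entries `a` and
`i` are swapped. -/
def ElementaryMove (i : ℕ) (S T : StandardSkewTableau lam mu) : Prop :=
  ∃ a b : ℕ, ((a = i + 1 ∧ b + 1 = i) ∨ (a + 1 = i ∧ b = i + 1)) ∧
    (∃ ca ∈ skewCells lam mu, ∃ cb ∈ skewCells lam mu, ∃ ci ∈ skewCells lam mu,
      S.entry ca = a ∧ S.entry cb = b ∧ S.entry ci = i ∧
        ((ReadsBefore ca cb ∧ ReadsBefore cb ci) ∨ (ReadsBefore ci cb ∧ ReadsBefore cb ca))) ∧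
    ∀ c, T.entry c = Equiv.swap a i (S.entry c)

/-- `S` and `T` are dual equivalent: they differ by a finite sequence of elementary dual
equivalence moves. -/
def DualEquivalent (S T : StandardSkewTableau lam mu) : Prop :=
  Relation.ReflTransGen (fun U V => ∃ i, ElementaryMove i U V) S T

end StandardSkewTableau

/-!
Both halves of the proof follow single slides.

*Equal stabilization.*  A slide commutes with elementary dual equivalence moves
(`IsHoled.isDualMove_slide`).  As long as two tableaux differ by exchanging two consecutive entries
and the same entry moves into the hole in both, one has to see that the rows of the three entries
`p`, `p + 1`, `p + 2` involved stay in the order that permits the exchange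
(`IsHoled.isDualMove_moveInto`).  The two slides diverge only if the three entries and the hole
form a square; they then run around the square on different sides, meet again in its lower right
corner, and turn an exchange of `p` and `p + 1` into one of `p + 1` and `p + 2`
(`IsHoled.isDualMove_square`).  Now if `T` results from `S` by a move, then `T^(k)` results from
`S^(k)` by `k` moves, one on each copy, and so do their rectifications.  Which two entries a move
exchanges can be told from the rows of the three entries, so that a move preserves the property
that the entries of the last copy have the same rows in the rectification as before it
(`forall_inRow_iff_of_isDualMove`).

*Existence.*  In `S^(k)` the row of the entry `x` depends only on `x` modulo the size `m` of `S`,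
and each window of `m` consecutive entries has as many entries in row `i` as `S`.  These numbers
weakly decrease with `i`.  If all entries larger than `B` are in their rows of `S^(k)`, a counting
argument (`IsHoled.le_of_isNext_below`) shows that no entry larger than `B + m` moves up in the
next step of a slide.  A slide moves entries up at most as often as there are rows, and the number
of slides is the number of cells of the inner shape; so only entries in a number of copies that
does not depend on `k` ever change their rows (`rowsAgree_foldl_slide`).
-/

/-! ### Slides in skew tableaux -/

/-- `f` is a skew tableau, with distinct entries at most `N`, whose inner shape is `M`: the empty
cells are marked by `0`, and the inner shape is disjoint from the nonempty cells and makes up an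
outer shape together with them. -/
structure IsSkewTableau (N : ℕ) (M : Set (ℕ × ℕ)) (f : ℕ × ℕ → ℕ) : Prop where
  lower : ∀ c d, c ≤ d → d ∈ M ∨ f d ≠ 0 → c ∈ M ∨ f c ≠ 0
  disj : ∀ c, f c ≠ 0 → c ∉ M
  mono : ∀ c d, c ≤ d → f c ≠ 0 → f d ≠ 0 → f c ≤ f d
  inj : ∀ c d, f c ≠ 0 → f c = f d → c = d
  bound : ∀ c, f c ≤ N

/-- `f` is a skew tableau of inner shape `M` together with the hole `h`, as it occurs in the course
of a slide.  The hole counts as part of the inner shape in `tab`, although the two together need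
not form a Young diagram. -/
structure IsHoled (N : ℕ) (M : Set (ℕ × ℕ)) (f : ℕ × ℕ → ℕ) (h : ℕ × ℕ) : Prop where
  tab : IsSkewTableau N (insert h M) f
  inner : IsLowerSet M
  hole : h ∉ M

/-- The slide that has reached the hole `h` of `f` continues with the entry in the cell `r`.  That
this entry is minimal among all the entries weakly below and to the right of the hole (not only
among the two neighbours) makes the two directions of a step alike. -/
def IsNext (f : ℕ × ℕ → ℕ) (h r : ℕ × ℕ) : Prop :=
  (r = (h.1, h.2 + 1) ∨ r = (h.1 + 1, h.2)) ∧ f r ≠ 0 ∧ ∀ d, h ≤ d → f d ≠ 0 → f r ≤ f d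

/-- Move the entry in the cell `r` into the hole `h`. -/
def moveInto (f : ℕ × ℕ → ℕ) (h r : ℕ × ℕ) : ℕ × ℕ → ℕ :=
  Function.update (Function.update f h (f r)) r 0

theorem moveInto_apply {f : ℕ × ℕ → ℕ} {h r : ℕ × ℕ} (c : ℕ × ℕ) :
    moveInto f h r c = if c = r then 0 else if c = h then f r else f c := by
  simp [moveInto, Function.update_apply]

theorem IsNext.ne {f : ℕ × ℕ → ℕ} {h r : ℕ × ℕ} (hr : IsNext f h r) : r ≠ h := by
  rcases hr.1 with rfl | rfl <;> simp [Prod.ext_iff]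

theorem IsNext.le {f : ℕ × ℕ → ℕ} {h r : ℕ × ℕ} (hr : IsNext f h r) : h ≤ r := by
  rcases hr.1 with rfl | rfl <;> simp [Prod.le_def]

namespace IsHoled

variable {N : ℕ} {M : Set (ℕ × ℕ)} {f : ℕ × ℕ → ℕ} {h r : ℕ × ℕ}

theorem apply_hole (H : IsHoled N M f h) : f h = 0 := by
  by_contra h0
  exact H.tab.disj h h0 (Set.mem_insert _ _)

/-- The nonempty cells and the hole form an order convex set. -/
theorem ne_zero_of_between (H : IsHoled N M f h) {c d e : ℕ × ℕ} (hc : f c ≠ 0 ∨ c = h)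
    (hd : f d ≠ 0) (hce : c ≤ e) (hed : e ≤ d) (he : e ≠ h) : f e ≠ 0 := by
  rcases H.tab.lower e d hed (Or.inr hd) with h1 | h1
  · rcases h1 with h1 | h1
    · exact absurd h1 he
    · have hcM := H.inner hce h1
      rcases hc with hc | rfl
      · exact absurd (Set.mem_insert_of_mem _ hcM) (H.tab.disj c hc)
      · exact absurd hcM H.hole
  · exact h1

theorem apply_lt_apply (H : IsHoled N M f h) {c d : ℕ × ℕ} (hcd : c ≤ d) (hne : c ≠ d)
    (hc : f c ≠ 0) (hd : f d ≠ 0) : f c < f d :=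
  lt_of_le_of_ne (H.tab.mono c d hcd hc hd) fun h1 => hne (H.tab.inj c d hc h1)

theorem exists_neighbour_le (H : IsHoled N M f h) {d : ℕ × ℕ} (hd : h ≤ d) (h0 : f d ≠ 0) :
    ∃ r, (r = (h.1, h.2 + 1) ∨ r = (h.1 + 1, h.2)) ∧ f r ≠ 0 ∧ f r ≤ f d := by
  have hne : d ≠ h := fun e => h0 (e ▸ H.apply_hole)
  have key : ∃ r, (r = (h.1, h.2 + 1) ∨ r = (h.1 + 1, h.2)) ∧ r ≤ d := by
    obtain ⟨i, j⟩ := h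
    obtain ⟨i', j'⟩ := d
    simp only [Prod.mk_le_mk] at hd
    by_cases hj : j = j'
    · refine ⟨_, Or.inr rfl, ?_⟩
      have : i ≠ i' := fun e => hne (by rw [e, hj])
      simp only [Prod.mk_le_mk]
      omega
    · refine ⟨_, Or.inl rfl, ?_⟩
      simp only [Prod.mk_le_mk]
      omega
  obtain ⟨r, hr, hrd⟩ := key
  have hr0 : f r ≠ 0 := by
    refine H.ne_zero_of_between (Or.inr rfl) h0 ?_ hrd ?_ <;>
      rcases hr with rfl | rfl <;> simp [Prod.le_def, Prod.ext_iff]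
  exact ⟨r, hr, hr0, H.tab.mono r d hrd hr0 h0⟩

theorem exists_isNext (H : IsHoled N M f h) (hex : ∃ d, h ≤ d ∧ f d ≠ 0) : ∃ r, IsNext f h r := by
  classical
  have hex' : ∃ v, ∃ d, h ≤ d ∧ f d ≠ 0 ∧ f d = v := by
    obtain ⟨d, h1, h2⟩ := hex
    exact ⟨_, d, h1, h2, rfl⟩
  obtain ⟨d, hd, hd0, hdv⟩ := Nat.find_spec hex'
  obtain ⟨r, hr, hr0, hrd⟩ := H.exists_neighbour_le hd hd0
  refine ⟨r, hr, hr0, fun e he he0 => ?_⟩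
  have := Nat.find_min' hex' ⟨e, he, he0, rfl⟩
  omega

theorem slide_succ (H : IsHoled N M f h) (hr : IsNext f h r) (n : ℕ) :
    slide (n + 1) f h = slide n (moveInto f h r) r := by
  obtain ⟨i, j⟩ := h
  have hR : f (i, j + 1) ≠ 0 → f r ≤ f (i, j + 1) := hr.2.2 (i, j + 1) (by simp)
  have hD : f (i + 1, j) ≠ 0 → f r ≤ f (i + 1, j) := hr.2.2 (i + 1, j) (by simp)
  have hinj := H.tab.inj (i, j + 1) (i + 1, j)
  have h0 := hr.2.1
  rcases hr.1 with rfl | rfl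
  · have : f (i, j + 1) ≠ f (i + 1, j) := fun e => by simpa using hinj h0 e
    rw [slide, if_pos]
    · rfl
    · refine ⟨h0, ?_⟩
      by_cases h1 : f (i + 1, j) = 0
      · exact Or.inl h1
      · have := hD h1
        simp only at this
        right; omega
  · rw [slide, if_neg, if_pos]
    · rfl
    · exact h0
    · rintro ⟨h1, h2⟩
      have := hR h1
      simp only at this h0
      omega

theorem slide_eq_self (hz : ∀ d, h ≤ d → f d = 0) (n : ℕ) : slide n f h = f := by
  obtain ⟨i, j⟩ := h
  have hR : f (i, j + 1) = 0 := hz _ (by simp)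
  have hD : f (i + 1, j) = 0 := hz _ (by simp)
  cases n with
  | zero => rfl
  | succ n => simp [slide, hR, hD]

theorem moveInto_isHoled (H : IsHoled N M f h) (hr : IsNext f h r) :
    IsHoled N M (moveInto f h r) r := by
  have hne := hr.ne
  have hle := hr.le
  have hr0 := hr.2.1
  have hh0 := H.apply_hole
  have hdisj := H.tab.disj
  have hrM : r ∉ M := fun h1 => hdisj r hr0 (Set.mem_insert_of_mem _ h1)
  have hshape : ∀ c, (c ∈ insert r M ∨ moveInto f h r c ≠ 0) ↔ (c ∈ insert h M ∨ f c ≠ 0) := by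
    intro c
    rw [moveInto_apply]
    by_cases h1 : c = r
    · subst h1; simp [hr0]
    · by_cases h2 : c = h
      · subst h2; simp [hr0, h1]
      · simp [h1, h2]
  refine ⟨⟨?_, ?_, ?_, ?_, ?_⟩, H.inner, hrM⟩
  · intro c d hcd
    rw [hshape, hshape]
    exact H.tab.lower c d hcd
  · intro c hc
    rw [moveInto_apply] at hc
    split_ifs at hc with h1 h2
    · exact absurd rfl hc
    · subst h2
      rintro (h3 | h3)
      · exact h1 h3
      · exact H.hole h3
    · rintro (h3 | h3)
      · exact h1 h3
      · exact hdisj c hc (Set.mem_insert_of_mem _ h3)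
  · intro c d hcd hc hd
    rw [moveInto_apply] at hc hd ⊢
    rw [moveInto_apply]
    split_ifs at hc hd ⊢ with h1 h2 h3 h4 h5 h6
    all_goals first | exact absurd rfl hc | exact absurd rfl hd | skip
    · exact le_rfl
    · subst h4; exact hr.2.2 d hcd hd
    · rename_i h6; subst h6; exact H.tab.mono c r (hcd.trans hle) hc hr0
    · exact H.tab.mono c d hcd hc hd
  · intro c d hc hcd
    rw [moveInto_apply] at hc
    rw [moveInto_apply, moveInto_apply] at hcd
    split_ifs at hc hcd with h1 h2 h3 h4 h5 h6
    all_goals first | exact absurd rfl hc | exact absurd hcd hc | skip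
    · rw [h4, h6]
    · exact absurd (H.tab.inj r d hr0 hcd).symm h5
    · exact absurd (H.tab.inj c r hc hcd) h1
    · exact H.tab.inj c d hc hcd
  · intro c
    rw [moveInto_apply]
    split_ifs
    · exact Nat.zero_le _
    · exact H.tab.bound r
    · exact H.tab.bound c

/-- The entry that moves is smaller than all entries that can still move: one unit of fuel is
enough for every step. -/
theorem fuel_moveInto (H : IsHoled N M f h) (hr : IsNext f h r) {n : ℕ}
    (hn : ∀ d, h ≤ d → f d ≠ 0 → N < f d + (n + 1)) (d : ℕ × ℕ) (hd : r ≤ d)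
    (h0 : moveInto f h r d ≠ 0) : N < moveInto f h r d + n := by
  have hdh : d ≠ h := by
    rintro rfl
    exact hr.ne (le_antisymm hd hr.le)
  rw [moveInto_apply] at h0 ⊢
  split_ifs at h0 ⊢ with h1
  · exact absurd rfl h0
  · have h2 := H.apply_lt_apply hd (Ne.symm h1) hr.2.1 h0
    have h3 := hn r hr.le hr.2.1
    omega

theorem fuel_pos (H : IsHoled N M f h) {n : ℕ} (hn : ∀ d, h ≤ d → f d ≠ 0 → N < f d + n)
    (hr : IsNext f h r) : ∃ n', n = n' + 1 := by
  have h1 := hn r hr.le hr.2.1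
  have h2 := H.tab.bound r
  exact ⟨n - 1, by omega⟩

theorem isSkewTableau_of_forall_eq_zero (H : IsHoled N M f h) (hz : ∀ d, h ≤ d → f d = 0) :
    IsSkewTableau N M f := by
  refine ⟨?_, ?_, H.tab.mono, H.tab.inj, H.tab.bound⟩
  · intro c d hcd hd
    have hdh : d ∈ insert h M ∨ f d ≠ 0 := hd.imp (Set.mem_insert_of_mem _) id
    rcases H.tab.lower c d hcd hdh with (h1 | h1) | h1
    · subst h1
      rcases hd with hd | hd
      · exact absurd (H.inner hcd hd) H.hole
      · exact absurd (hz d hcd) hd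
    · exact Or.inl h1
    · exact Or.inr h1
  · intro c hc hcM
    exact H.tab.disj c hc (Set.mem_insert_of_mem _ hcM)

theorem slide_isSkewTableau {n : ℕ} : ∀ {f : ℕ × ℕ → ℕ} {h : ℕ × ℕ}, IsHoled N M f h →
    (∀ d, h ≤ d → f d ≠ 0 → N < f d + n) → IsSkewTableau N M (slide n f h) := by
  induction n with
  | zero =>
    intro f h H hn
    have hz : ∀ d, h ≤ d → f d = 0 := by
      intro d hd
      by_contra h0
      have h1 := hn d hd h0
      have h2 := H.tab.bound d
      omega
    rw [slide_eq_self hz]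
    exact H.isSkewTableau_of_forall_eq_zero hz
  | succ n ih =>
    intro f h H hn
    by_cases hz : ∀ d, h ≤ d → f d = 0
    · rw [slide_eq_self hz]
      exact H.isSkewTableau_of_forall_eq_zero hz
    · push Not at hz
      obtain ⟨r, hr⟩ := H.exists_isNext hz
      rw [H.slide_succ hr]
      exact ih (H.moveInto_isHoled hr) (H.fuel_moveInto hr hn)

end IsHoled

/-! ### Elementary dual equivalence moves -/

/-- `g` results from `f` by an elementary dual equivalence move on the entries `p`, `p + 1` and
`p + 2`, which are in the order `p + 1, p, p + 2` or `p, p + 2, p + 1` in the reading word of `f`.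
In a tableau the reading order of these entries can be told from their rows.  The moves that start
from the other two orders are those with `f` and `g` exchanged. -/
def IsDualMove (p : ℕ) (f g : ℕ × ℕ → ℕ) : Prop :=
  p ≠ 0 ∧ ∃ c₀ c₁ c₂ : ℕ × ℕ, f c₀ = p ∧ f c₁ = p + 1 ∧ f c₂ = p + 2 ∧
    ((c₂.1 ≤ c₀.1 ∧ c₀.1 < c₁.1 ∧ ∀ c, g c = Equiv.swap (p + 1) (p + 2) (f c)) ∨
      (c₁.1 < c₂.1 ∧ c₂.1 ≤ c₀.1 ∧ ∀ c, g c = Equiv.swap p (p + 1) (f c)))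

theorem swap_succ_apply (p x : ℕ) : Equiv.swap p (p + 1) x =
    if x = p then p + 1 else if x = p + 1 then p else x :=
  Equiv.swap_apply_def ..

theorem swap_succ_eq_zero_iff {p : ℕ} (hp : p ≠ 0) (x : ℕ) :
    Equiv.swap p (p + 1) x = 0 ↔ x = 0 := by
  rw [swap_succ_apply]
  split_ifs with h1 h2
  · simp [h1, hp]
  · simp [h2, hp]
  · rfl

/-- Exchanging two consecutive entries of a skew tableau gives a skew tableau if the larger one is
in a higher row. -/
theorem IsSkewTableau.swap {N p : ℕ} {M : Set (ℕ × ℕ)} {f g : ℕ × ℕ → ℕ} {c d : ℕ × ℕ}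
    (F : IsSkewTableau N M f) (hp : p ≠ 0) (hc : f c = p) (hd : f d = p + 1) (hdc : d.1 < c.1)
    (hg : ∀ c, g c = Equiv.swap p (p + 1) (f c)) : IsSkewTableau N M g := by
  have h0 : ∀ e, g e = 0 ↔ f e = 0 := fun e => by rw [hg, swap_succ_eq_zero_iff hp]
  refine ⟨?_, ?_, ?_, ?_, ?_⟩
  · intro a b hab
    rw [ne_eq, ne_eq, h0, h0]
    exact F.lower a b hab
  · intro a ha
    rw [ne_eq, h0] at ha
    exact F.disj a ha
  · intro a b hab ha hb
    rw [ne_eq, h0] at ha hb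
    have h1 := F.mono a b hab ha hb
    rw [hg, hg, swap_succ_apply, swap_succ_apply]
    by_cases h2 : f a = p ∧ f b = p + 1
    · have ha' := F.inj a c ha (h2.1.trans hc.symm)
      have hb' := F.inj b d hb (h2.2.trans hd.symm)
      subst ha' hb'
      have := hab.1
      omega
    · split_ifs <;> omega
  · intro a b ha hab
    rw [ne_eq, h0] at ha
    rw [hg, hg] at hab
    exact F.inj a b ha ((Equiv.swap p (p + 1)).injective hab)
  · intro a
    have h1 := F.bound a
    have h2 := F.bound d
    rw [hg, swap_succ_apply]
    split_ifs <;> omega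

theorem IsDualMove.isSkewTableau {N p : ℕ} {M : Set (ℕ × ℕ)} {f g : ℕ × ℕ → ℕ}
    (D : IsDualMove p f g) (F : IsSkewTableau N M f) : IsSkewTableau N M g := by
  obtain ⟨hp, c₀, c₁, c₂, h0, h1, h2, ⟨h3, h4, h5⟩ | ⟨h3, h4, h5⟩⟩ := D
  · exact F.swap (p := p + 1) (by omega) h1 h2 (by omega) h5
  · exact F.swap hp h0 h1 (by omega) h5

/-! ### Slides commute with elementary dual equivalence moves -/

theorem apply_moveInto_ite {f : ℕ × ℕ → ℕ} {h r c : ℕ × ℕ} (hh : f h = 0) (hc : f c ≠ 0)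
    (hr : r ≠ h) : moveInto f h r (if c = r then h else c) = f c := by
  rw [moveInto_apply]
  by_cases h1 : c = r
  · simp [h1, hr.symm]
  · have h2 : c ≠ h := fun e => hc (e ▸ hh)
    simp [h1, h2]

theorem moveInto_swap {f g : ℕ × ℕ → ℕ} {p : ℕ} (hp : p ≠ 0)
    (hg : ∀ c, g c = Equiv.swap p (p + 1) (f c)) (h r c : ℕ × ℕ) :
    moveInto g h r c = Equiv.swap p (p + 1) (moveInto f h r c) := by
  rw [moveInto_apply, moveInto_apply]
  split_ifs
  · exact ((swap_succ_eq_zero_iff hp 0).2 rfl).symm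
  · exact hg r
  · exact hg c

theorem IsNext.swap {f g : ℕ × ℕ → ℕ} {h r : ℕ × ℕ} {p : ℕ} (hr : IsNext f h r) (hp : p ≠ 0)
    (hg : ∀ c, g c = Equiv.swap p (p + 1) (f c))
    (hn : f r = p → ∀ d, h ≤ d → f d ≠ p + 1) : IsNext g h r := by
  have h0 : ∀ e, g e = 0 ↔ f e = 0 := fun e => by rw [hg, swap_succ_eq_zero_iff hp]
  refine ⟨hr.1, fun e => hr.2.1 ((h0 r).1 e), fun d hd hd0 => ?_⟩
  rw [ne_eq, h0] at hd0
  have h1 := hr.2.2 d hd hd0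
  have h2 : f r = p → f d ≠ p + 1 := fun e => hn e d hd
  rw [hg, hg, swap_succ_apply, swap_succ_apply]
  split_ifs <;> omega

namespace IsHoled

variable {N : ℕ} {M : Set (ℕ × ℕ)} {f : ℕ × ℕ → ℕ} {h r : ℕ × ℕ}

/-- If the entry below the hole moves up, its predecessor is not in the row of the hole. -/
theorem row_ne_of_succ (H : IsHoled N M f h) (hr : IsNext f h r) (hrow : r.1 = h.1 + 1)
    {c : ℕ × ℕ} (hc : f c ≠ 0) (hcr : f r = f c + 1) : c.1 ≠ h.1 := by
  intro hch
  have hr2 : r.2 = h.2 := by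
    rcases hr.1 with rfl | rfl <;> simp_all
  by_cases h2 : h.2 ≤ c.2
  · have := hr.2.2 c ⟨hch.ge, h2⟩ hc
    omega
  · -- the cell below that of the predecessor would hold an entry strictly between the two
    have hce : c ≤ (r.1, c.2) := ⟨by simp only; omega, le_rfl⟩
    have her : (r.1, c.2) ≤ r := ⟨le_rfl, by simp only; omega⟩
    have he : f (r.1, c.2) ≠ 0 := by
      refine H.ne_zero_of_between (Or.inl hc) hr.2.1 hce her fun e => ?_
      have := congrArg Prod.fst e
      simp only at this
      omega
    have h3 := H.apply_lt_apply hce (fun e => by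
      have := congrArg Prod.fst e
      simp only at this
      omega) hc he
    have h4 := H.apply_lt_apply her (fun e => by
      have := congrArg Prod.snd e
      simp only at this
      omega) he hr.2.1
    omega

/-- If the entry `x` below the hole moves up and `x + 2` is in the row of `x`, then `x + 1` is
above `x + 2`. -/
theorem apply_above (H : IsHoled N M f h) (hr : IsNext f h r) (hrow : r.1 = h.1 + 1)
    {c : ℕ × ℕ} (hc : f c = f r + 2) (hcr : c.1 = r.1) :
    h ≤ (h.1, c.2) ∧ f (h.1, c.2) = f r + 1 := by
  have hr2 : r.2 = h.2 := by
    rcases hr.1 with rfl | rfl <;> simp_all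
  have hc0 : f c ≠ 0 := by omega
  have hlt : r.2 < c.2 := by
    by_contra h1
    have := H.tab.mono c r ⟨hcr.le, by omega⟩ hc0 hr.2.1
    omega
  have hhe : h ≤ (h.1, c.2) := ⟨le_rfl, by simp only; omega⟩
  have hec : (h.1, c.2) ≤ c := ⟨by simp only; omega, le_rfl⟩
  have he : f (h.1, c.2) ≠ 0 := by
    refine H.ne_zero_of_between (Or.inr rfl) hc0 hhe hec fun e => ?_
    have := congrArg Prod.snd e
    simp only at this
    omega
  refine ⟨hhe, ?_⟩
  have h3 := hr.2.2 _ hhe he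
  have h4 := H.apply_lt_apply hec (fun e => by
    have := congrArg Prod.fst e
    simp only at this
    omega) he hc0
  have h5 : f r ≠ f (h.1, c.2) := fun e => by
    have := congrArg Prod.fst (H.tab.inj _ _ hr.2.1 e)
    simp only at this
    omega
  omega

theorem row_of_isNext (hr : IsNext f h r) : r.1 = h.1 ∨ r.1 = h.1 + 1 := by
  rcases hr.1 with rfl | rfl <;> simp

theorem row_ite (c : ℕ × ℕ) : (if c = r then h else c).1 = if c = r then h.1 else c.1 := by
  split_ifs <;> rfl

/-- One step of a slide commutes with an elementary dual equivalence move, unless the entries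
`p, p + 1, p + 2` fill a square with the hole in the upper left corner. -/
theorem isDualMove_moveInto (H : IsHoled N M f h) (hr : IsNext f h r) {g : ℕ × ℕ → ℕ} {p : ℕ}
    (D : IsDualMove p f g) :
    (IsNext g h r ∧ IsDualMove p (moveInto f h r) (moveInto g h r)) ∨
      ((∀ c, g c = Equiv.swap p (p + 1) (f c)) ∧ r = (h.1 + 1, h.2) ∧ p ≠ 0 ∧
        f (h.1 + 1, h.2) = p ∧ f (h.1, h.2 + 1) = p + 1 ∧ f (h.1 + 1, h.2 + 1) = p + 2) := by
  have hrow := row_of_isNext hr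
  have hne := hr.ne
  have hh0 := H.apply_hole
  obtain ⟨hp, c₀, c₁, c₂, h0, h1, h2, D⟩ := D
  have e0 := apply_moveInto_ite (c := c₀) hh0 (by omega) hne
  have e1 := apply_moveInto_ite (c := c₁) hh0 (by omega) hne
  have e2 := apply_moveInto_ite (c := c₂) hh0 (by omega) hne
  have n01 : c₀ ≠ c₁ := by rintro rfl; omega
  have n02 : c₀ ≠ c₂ := by rintro rfl; omega
  have n12 : c₁ ≠ c₂ := by rintro rfl; omega
  have hloc : ∀ c v, f v ≠ 0 → f c = f v → c = v := fun c v hv e =>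
    (H.tab.inj v c hv e.symm).symm
  rcases D with ⟨h3, h4, h5⟩ | ⟨h3, h4, h5⟩
  · left
    have k1 : r.1 = h.1 + 1 → r = c₁ → c₀.1 ≠ h.1 := fun e e' =>
      H.row_ne_of_succ hr e (by omega) (by rw [e']; omega)
    have k2 : r.1 = h.1 + 1 → r = c₀ → c₂.1 ≠ r.1 := fun e e' e'' => by
      have h6 := H.apply_above hr e (c := c₂) (by rw [e']; omega) e''
      have h7 := hloc c₁ (h.1, c₂.2) (by omega) (by rw [h6.2, e']; omega)
      have h8 := congrArg Prod.fst h7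
      simp only at h8
      subst e'
      omega
    refine ⟨hr.swap (by omega) h5 fun h6 d hd h7 => ?_, hp, _, _, _, e0.trans h0, e1.trans h1,
      e2.trans h2, Or.inl ⟨?_, ?_, moveInto_swap (by omega) h5 h r⟩⟩
    · have h8 := hloc r c₁ (by omega) (by omega)
      have h9 := hloc d c₂ (by omega) (by omega)
      have h10 := hd.1
      have h11 := congrArg Prod.fst h8
      have h12 := congrArg Prod.fst h9
      have h13 : r.1 = h.1 + 1 → c₀.1 ≠ h.1 := fun e => k1 e h8
      omega
    · rw [row_ite, row_ite]
      split_ifs with h6 h7 h7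
      · exact absurd (h7.trans h6.symm) n02
      · subst h6; omega
      · subst h7; have := k2; simp only [true_implies] at this; omega
      · exact h3
    · rw [row_ite, row_ite]
      split_ifs with h6 h7 h7
      · exact absurd (h6.trans h7.symm) n01
      · subst h6; omega
      · subst h7; have := k1; simp only [true_implies] at this; omega
      · exact h4
  · by_cases hex : f r = p ∧ ∃ d, h ≤ d ∧ f d = p + 1
    · -- the square
      right
      obtain ⟨h6, d, hd, h7⟩ := hex
      have h8 := hloc r c₀ (by omega) (by omega)
      have h9 := hloc d c₁ (by omega) (by omega)
      subst h8 h9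
      have hrow' : r.1 = h.1 + 1 := by have := hd.1; omega
      have hr2 : r = (h.1 + 1, h.2) := by
        rcases hr.1 with h10 | h10
        · have := congrArg Prod.fst h10
          simp only at this
          omega
        · exact h10
      have hr2' : r.2 = h.2 := by rw [hr2]
      have hc2 : c₂.1 = r.1 := by have := hd.1; omega
      have hd1 : d.1 = h.1 := by have := hd.1; omega
      have h10 := H.apply_above hr hrow' (c := c₂) (by omega) hc2
      have h11 := hloc (h.1, c₂.2) d (by omega) (by omega)
      have h12 : d.2 = c₂.2 := (congrArg Prod.snd h11).symm
      have h13 : h.2 < d.2 := by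
        refine _root_.lt_of_le_of_ne hd.2 fun e => ?_
        have : h = d := Prod.ext hd1.symm e
        subst this
        omega
      have h14 : (h.1, h.2 + 1) ≤ d := ⟨hd1.ge, h13⟩
      have h15 : f (h.1, h.2 + 1) ≠ 0 := by
        refine H.ne_zero_of_between (Or.inr rfl) (by omega) ⟨le_rfl, by simp⟩ h14 fun e => ?_
        have := congrArg Prod.snd e
        simp at this
      have h16 := H.tab.mono _ _ h14 h15 (by omega)
      have h17 := hr.2.2 (h.1, h.2 + 1) ⟨le_rfl, by simp⟩ h15
      have h18 : f r ≠ f (h.1, h.2 + 1) := fun e => by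
        have := congrArg Prod.fst (H.tab.inj _ _ hr.2.1 e)
        simp only at this
        omega
      have h19 := hloc (h.1, h.2 + 1) d (by omega) (by omega)
      have h20 : (h.1 + 1, h.2 + 1) = c₂ := by
        have h21 := congrArg Prod.snd h19
        simp only at h21
        exact Prod.ext (by simp only; omega) (by simp only; omega)
      exact ⟨h5, hr2, hp, hr2 ▸ h6, by omega, h20 ▸ h2⟩
    · left
      push Not at hex
      have k1 : r.1 = h.1 + 1 → r = c₂ → c₁.1 ≠ h.1 := fun e e' =>
        H.row_ne_of_succ hr e (by omega) (by rw [e']; omega)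
      have k2 : r.1 = h.1 + 1 → r = c₀ → c₂.1 ≠ r.1 := fun e e' e'' => by
        have h6 := H.apply_above hr e (c := c₂) (by rw [e']; omega) e''
        refine hex (by rw [e', h0]) _ h6.1 ?_
        rw [h6.2, e', h0]
      refine ⟨hr.swap hp h5 hex, hp, _, _, _, e0.trans h0, e1.trans h1,
        e2.trans h2, Or.inr ⟨?_, ?_, moveInto_swap hp h5 h r⟩⟩
      · rw [row_ite, row_ite]
        split_ifs with h6 h7 h7
        · exact absurd (h6.trans h7.symm) n12
        · subst h6; omega
        · subst h7; have := k1; simp only [true_implies] at this; omega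
        · exact h3
      · rw [row_ite, row_ite]
        split_ifs with h6 h7 h7
        · exact absurd (h7.trans h6.symm) n02
        · subst h6; omega
        · subst h7; have := k2; simp only [true_implies] at this; omega
        · exact h4

/-- The exceptional square: the two slides run around it on different sides and meet in its lower
right corner, where the two tableaux again differ by a dual equivalence move, of the other kind. -/
theorem isDualMove_square (H : IsHoled N M f h) {g : ℕ × ℕ → ℕ} {p : ℕ} (hp : p ≠ 0)
    (hg : ∀ c, g c = Equiv.swap p (p + 1) (f c)) (G : IsHoled N M g h)
    (hr : IsNext f h (h.1 + 1, h.2))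
    (h0 : f (h.1 + 1, h.2) = p) (h1 : f (h.1, h.2 + 1) = p + 1)
    (h2 : f (h.1 + 1, h.2 + 1) = p + 2) :
    IsNext g h (h.1, h.2 + 1) ∧
      IsNext (moveInto f h (h.1 + 1, h.2)) (h.1 + 1, h.2) (h.1 + 1, h.2 + 1) ∧
      IsNext (moveInto g h (h.1, h.2 + 1)) (h.1, h.2 + 1) (h.1 + 1, h.2 + 1) ∧
      IsDualMove p (moveInto (moveInto g h (h.1, h.2 + 1)) (h.1, h.2 + 1) (h.1 + 1, h.2 + 1))
        (moveInto (moveInto f h (h.1 + 1, h.2)) (h.1 + 1, h.2) (h.1 + 1, h.2 + 1)) := by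
  obtain ⟨a, b⟩ := h
  simp only at *
  have hh0 := H.apply_hole
  have g0 : g (a + 1, b) = p + 1 := by rw [hg, h0, Equiv.swap_apply_left]
  have g1 : g (a, b + 1) = p := by rw [hg, h1, Equiv.swap_apply_right]
  have g2 : g (a + 1, b + 1) = p + 2 := by
    rw [hg, h2, Equiv.swap_apply_of_ne_of_ne] <;> omega
  have hz : ∀ e, g e = 0 ↔ f e = 0 := fun e => by rw [hg, swap_succ_eq_zero_iff hp]
  have hmin := hr.2.2
  have i0 : ∀ c, f c = p → c = (a + 1, b) := fun c hc => H.tab.inj _ _ (by omega) (by omega)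
  have i1 : ∀ c, f c = p + 1 → c = (a, b + 1) := fun c hc => H.tab.inj _ _ (by omega) (by omega)
  have hgne : ∀ c, f c ≠ p → f c ≠ p + 1 → g c = f c := fun c hc hc' => by
    rw [hg, Equiv.swap_apply_of_ne_of_ne hc hc']
  refine ⟨⟨Or.inl rfl, by omega, fun d hd hd0 => ?_⟩, ⟨Or.inl rfl, ?_, fun d hd hd0 => ?_⟩,
    ⟨Or.inr rfl, ?_, fun d hd hd0 => ?_⟩, ?_⟩
  · have h3 := hmin d hd (fun e => hd0 ((hz d).2 e))
    rw [g1, hg, swap_succ_apply]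
    split_ifs <;> omega
  · simp [moveInto_apply, h2]
  · have h3 : (a, b) ≤ d := le_trans (by simp) hd
    have h4 := hd.1
    simp only at h4
    have h5 : d ≠ (a, b) := by rintro rfl; simp at h4
    rw [moveInto_apply] at hd0
    simp only [moveInto_apply, Prod.mk.injEq, h5, if_false]
    split_ifs at hd0 with h6
    · exact absurd rfl hd0
    · have h7 := hmin d h3 hd0
      have h8 : f d ≠ p := fun e => h6 (i0 d e)
      have h9 : f d ≠ p + 1 := fun e => by
        rw [i1 d e] at h4
        simp at h4
      simp [h6, h2]
      omega
  · simp [moveInto_apply, g2]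
  · have h3 : (a, b) ≤ d := le_trans (by simp) hd
    have h4 := hd.2
    simp only at h4
    have h5 : d ≠ (a, b) := by rintro rfl; simp at h4
    rw [moveInto_apply] at hd0
    simp only [moveInto_apply, Prod.mk.injEq, h5, if_false]
    split_ifs at hd0 with h6
    · exact absurd rfl hd0
    · have h7 := hmin d h3 (fun e => hd0 ((hz d).2 e))
      have h8 : f d ≠ p + 1 := fun e => h6 (i1 d e)
      have h9 : f d ≠ p := fun e => by
        rw [i0 d e] at h4
        simp at h4
      have h10 := hgne d h9 h8
      simp [h6, g2]
      omega
  · refine ⟨hp, (a, b), (a + 1, b), (a, b + 1), ?_, ?_, ?_, Or.inl ⟨le_rfl, by simp, fun c => ?_⟩⟩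
    · simp [moveInto_apply, g1]
    · simp [moveInto_apply, g0]
    · simp [moveInto_apply, g2]
    · simp only [moveInto_apply]
      by_cases q1 : c = (a + 1, b + 1)
      · subst q1; simp [Equiv.swap_apply_def]
      by_cases q2 : c = (a + 1, b)
      · subst q2; simp [h2, g0]
      by_cases q3 : c = (a, b + 1)
      · subst q3; simp [h1, g2]
      by_cases q4 : c = (a, b)
      · subst q4; simp [h0, g1, Equiv.swap_apply_def]
      have q5 : f c ≠ p := fun e => q2 (i0 c e)
      have q6 : f c ≠ p + 1 := fun e => q3 (i1 c e)
      have q7 : f c ≠ p + 2 := fun e => q1 (H.tab.inj _ _ (by omega) (by omega))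
      simp only [q1, q2, q3, q4, if_false]
      rw [hgne c q5 q6, Equiv.swap_apply_of_ne_of_ne q6 q7]

/-- A slide commutes with elementary dual equivalence moves. -/
theorem isDualMove_slide {p : ℕ} : ∀ (n : ℕ) {f g : ℕ × ℕ → ℕ} {h : ℕ × ℕ}, IsHoled N M f h →
    (∀ d, h ≤ d → f d ≠ 0 → N < f d + n) → IsDualMove p f g →
    IsDualMove p (slide n f h) (slide n g h) ∨ IsDualMove p (slide n g h) (slide n f h) := by
  intro n
  induction n using Nat.strong_induction_on with
  | _ n ih =>
    intro f g h H hn D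
    have G : IsHoled N M g h := ⟨D.isSkewTableau H.tab, H.inner, H.hole⟩
    by_cases hz : ∀ d, h ≤ d → f d = 0
    · have hz' : ∀ d, h ≤ d → g d = 0 := by
        intro d hd
        obtain ⟨hp, _, _, _, _, _, _, ⟨_, _, h5⟩ | ⟨_, _, h5⟩⟩ := D
        · rw [h5, hz d hd, swap_succ_eq_zero_iff (by omega)]
        · rw [h5, hz d hd, swap_succ_eq_zero_iff hp]
      rw [slide_eq_self hz, slide_eq_self hz']
      exact Or.inl D
    · push Not at hz
      obtain ⟨r, hr⟩ := H.exists_isNext hz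
      obtain ⟨n, rfl⟩ := H.fuel_pos hn hr
      have H1 := H.moveInto_isHoled hr
      have hn1 := H.fuel_moveInto hr hn
      rcases H.isDualMove_moveInto hr D with ⟨hr', D'⟩ | ⟨hg, rfl, hp, h0, h1, h2⟩
      · rw [H.slide_succ hr, G.slide_succ hr']
        exact ih n (by omega) H1 hn1 D'
      · obtain ⟨r1, r2, r3, D'⟩ := H.isDualMove_square hp hg G hr h0 h1 h2
        obtain ⟨n, rfl⟩ := H1.fuel_pos hn1 r2
        have G1 := G.moveInto_isHoled r1
        have hz0 : ∀ e, g e = 0 ↔ f e = 0 := fun e => by rw [hg, swap_succ_eq_zero_iff hp]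
        have hnG : ∀ d, h ≤ d → g d ≠ 0 → N < g d + (n + 1 + 1) := by
          intro d hd hd0
          have h3 := hn _ hr.le hr.2.1
          have h4 := r1.2.2 d hd hd0
          have h5 : g (h.1, h.2 + 1) = p := by rw [hg, h1, Equiv.swap_apply_right]
          omega
        rw [H.slide_succ hr, G.slide_succ r1, H1.slide_succ r2, G1.slide_succ r3]
        exact (ih n (by omega) (G1.moveInto_isHoled r3)
          (G1.fuel_moveInto r3 (G.fuel_moveInto r1 hnG)) D').symm

end IsHoled

/-! ### Rectification as a sequence of slides -/

/-- The cells of an inner shape, listed in an order in which they can be removed one after the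
other. -/
def IsRemovalOrder (l : List (ℕ × ℕ)) : Prop :=
  IsLowerSet {c | c ∈ l} ∧ l.Pairwise fun c d => ¬ c ≤ d

theorem IsRemovalOrder.tail {c : ℕ × ℕ} {l : List (ℕ × ℕ)} (hl : IsRemovalOrder (c :: l)) :
    IsRemovalOrder l := by
  obtain ⟨h1, h2⟩ := hl
  rw [List.pairwise_cons] at h2
  refine ⟨fun a b hba ha => ?_, h2.2⟩
  have h3 : b ∈ c :: l := h1 hba (List.mem_cons_of_mem _ ha)
  rcases List.mem_cons.1 h3 with rfl | h3
  · exact absurd hba (h2.1 a ha)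
  · exact h3

theorem IsRemovalOrder.isHoled {c : ℕ × ℕ} {l : List (ℕ × ℕ)} (hl : IsRemovalOrder (c :: l))
    {N : ℕ} {f : ℕ × ℕ → ℕ} (F : IsSkewTableau N {d | d ∈ c :: l} f) :
    IsHoled N {d | d ∈ l} f c := by
  refine ⟨?_, hl.tail.1, fun hc => (List.pairwise_cons.1 hl.2).1 c hc le_rfl⟩
  have : insert c {d | d ∈ l} = {d | d ∈ c :: l} := by
    ext d
    simp
  rw [this]
  exact F

theorem isRemovalOrder_slideStarts (mu : YoungDiagram) : IsRemovalOrder (slideStarts mu) := by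
  refine ⟨?_, ?_⟩
  · intro c d hdc hc
    simp only [slideStarts, Set.mem_ofPred_eq, List.mem_flatMap, List.mem_reverse, List.mem_range,
      List.mem_map] at hc ⊢
    obtain ⟨i, hi, j, hj, rfl⟩ := hc
    obtain ⟨i', j'⟩ := d
    rw [Prod.mk_le_mk] at hdc
    exact ⟨i', by omega, j', by have := mu.rowLen_anti i' i hdc.1; omega, rfl⟩
  · rw [slideStarts, List.pairwise_flatMap]
    refine ⟨fun i _ => ?_, ?_⟩
    · rw [List.pairwise_map, List.pairwise_reverse]
      refine List.pairwise_lt_range.imp ?_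
      intro a b hab
      simpa using hab
    · rw [List.pairwise_reverse]
      refine List.pairwise_lt_range.imp ?_
      intro a b hab c hc d hd
      simp only [List.mem_map] at hc hd
      obtain ⟨_, _, rfl⟩ := hc
      obtain ⟨_, _, rfl⟩ := hd
      simp only [Prod.mk_le_mk]
      omega

theorem mem_slideStarts {mu : YoungDiagram} {c : ℕ × ℕ} :
    c ∈ slideStarts mu ↔ c.2 < mu.rowLen c.1 := by
  obtain ⟨i, j⟩ := c
  simp only [slideStarts, List.mem_flatMap, List.mem_reverse, List.mem_range, List.mem_map,
    Prod.mk.injEq]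
  constructor
  · rintro ⟨i', _, j', hj, rfl, rfl⟩
    exact hj
  · intro hj
    refine ⟨i, ?_, j, hj, rfl, rfl⟩
    rw [← YoungDiagram.mem_iff_lt_colLen]
    exact mu.up_left_mem le_rfl (Nat.zero_le j) (YoungDiagram.mem_iff_lt_rowLen.2 hj)

theorem IsSkewTableau.foldl_slide {N : ℕ} : ∀ {l : List (ℕ × ℕ)} {f : ℕ × ℕ → ℕ},
    IsRemovalOrder l → IsSkewTableau N {c | c ∈ l} f →
      IsSkewTableau N ∅ (l.foldl (slide N) f) := by
  intro l
  induction l with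
  | nil => intro f _ F; simpa using F
  | cons c l ih =>
    intro f hl F
    exact ih hl.tail ((hl.isHoled F).slide_isSkewTableau fun d _ hd => by omega)

theorem isDualMove_foldl_slide {N p : ℕ} : ∀ {l : List (ℕ × ℕ)} {f g : ℕ × ℕ → ℕ},
    IsRemovalOrder l → IsSkewTableau N {c | c ∈ l} f → IsSkewTableau N {c | c ∈ l} g →
      IsDualMove p f g ∨ IsDualMove p g f →
      IsDualMove p (l.foldl (slide N) f) (l.foldl (slide N) g) ∨
        IsDualMove p (l.foldl (slide N) g) (l.foldl (slide N) f) := by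
  intro l
  induction l with
  | nil => intro f g _ _ _ D; exact D
  | cons c l ih =>
    intro f g hl F G D
    have HF := hl.isHoled F
    have HG := hl.isHoled G
    refine ih hl.tail (HF.slide_isSkewTableau fun d _ hd => by omega)
      (HG.slide_isSkewTableau fun d _ hd => by omega) ?_
    rcases D with D | D
    · exact HF.isDualMove_slide N (fun d _ hd => by omega) D
    · exact (HG.isDualMove_slide N (fun d _ hd => by omega) D).symm

/-! ### Slides in the periodic part -/

/-- All entries `x` of the filling `f` with `B < x ≤ N` are in the rows `ρ x`. -/
def RowsAgree (N B : ℕ) (ρ : ℕ → ℕ) (f : ℕ × ℕ → ℕ) : Prop :=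
  ∀ x, B < x → x ≤ N → ∃ j, f (ρ x, j) = x

theorem RowsAgree.mono {N B B' : ℕ} {ρ : ℕ → ℕ} {f : ℕ × ℕ → ℕ} (h : RowsAgree N B ρ f)
    (hB : B ≤ B') : RowsAgree N B' ρ f :=
  fun x hx => h x (by omega)

/-- The word `ρ` is periodic of period `m`, each letter `i` occurs `r i` times in a period, and
smaller letters occur at least as often as larger ones. -/
structure IsBalanced (m : ℕ) (ρ r : ℕ → ℕ) : Prop where
  pos : 0 < m
  periodic : ∀ x, ρ (x + m) = ρ x
  card : ∀ y i, ((Finset.Ioc y (y + m)).filter fun x => ρ x = i).card = r i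
  anti : Antitone r

section Tail

variable {N m B : ℕ} {M : Set (ℕ × ℕ)} {f : ℕ × ℕ → ℕ} {h r : ℕ × ℕ} {ρ s : ℕ → ℕ}

theorem RowsAgree.row_eq {N' : ℕ} (A : RowsAgree N B ρ f) (F : IsSkewTableau N' M f) {c : ℕ × ℕ}
    (h1 : B < f c) (h2 : f c ≤ N) : ρ (f c) = c.1 := by
  obtain ⟨j, hj⟩ := A (f c) h1 h2
  exact congrArg Prod.fst (F.inj _ _ (by omega) hj)

theorem inRow_iff_of_rowsAgree {x i : ℕ} (A : RowsAgree N B ρ f) (F : IsSkewTableau N M f)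
    (h1 : B < x) (h2 : x ≤ N) : InRow f x i ↔ ρ x = i := by
  constructor
  · rintro ⟨j, rfl⟩
    exact A.row_eq F h1 h2
  · rintro rfl
    exact A x h1 h2

/-- In the periodic part of a tableau with weakly decreasing row contents, no entry moves up.  Let
`y` move up from row `i + 1`, column `b`, and suppose that `y - m` is in row `i + 1`, too, in
column `c`.  The entries in row `i` strictly between `y - m` and `y` lie left of column `b`, as
`y` is the smallest entry that can move, and right of column `c`, as columns increase.  So there
are at most `b - c - 1` of them, while row `i + 1` has at least `b - c` entries in the half open
interval from `y - m` to `y`. -/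
theorem IsHoled.le_of_isNext_below (H : IsHoled N M f h) (hr : IsNext f h (h.1 + 1, h.2))
    (P : IsBalanced m ρ s) (A : RowsAgree N B ρ f) : f (h.1 + 1, h.2) ≤ B + m := by
  obtain ⟨a, b⟩ := h
  simp only at *
  by_contra hy
  have hm := P.pos
  obtain ⟨x, hx⟩ : ∃ x, f (a + 1, b) = x + m := ⟨f (a + 1, b) - m, by omega⟩
  have hN := H.tab.bound (a + 1, b)
  have hrow : ρ (x + m) = a + 1 := by
    rw [← hx]
    exact A.row_eq H.tab (by omega) hN
  obtain ⟨c, hc⟩ := A x (by omega) (by omega)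
  rw [← P.periodic, hrow] at hc
  have hcb : c < b := by
    by_contra h1
    have := H.tab.mono (a + 1, b) (a + 1, c) ⟨le_rfl, by simp only; omega⟩ (by omega) (by omega)
    omega
  have hA : b - c ≤ s (a + 1) := by
    rw [← P.card x (a + 1), ← Nat.card_Ioc]
    refine Finset.card_le_card_of_injOn (fun j => f (a + 1, j)) ?_ ?_
    · intro j hj
      simp only [Finset.coe_Ioc, Set.mem_Ioc] at hj
      have hcj : ((a + 1, c) : ℕ × ℕ) ≤ (a + 1, j) := ⟨le_rfl, by simp only; omega⟩
      have hjb : ((a + 1, j) : ℕ × ℕ) ≤ (a + 1, b) := ⟨le_rfl, by simp only; omega⟩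
      have hj0 : f (a + 1, j) ≠ 0 :=
        H.ne_zero_of_between (Or.inl (by omega)) hr.2.1 hcj hjb (by simp)
      have h1 := H.apply_lt_apply hcj (by simp; omega) (by omega) hj0
      have h2 := H.tab.mono _ _ hjb hj0 hr.2.1
      simp only [Finset.coe_filter, Finset.mem_Ioc, Set.mem_ofPred_eq]
      exact ⟨by omega, A.row_eq H.tab (by omega) (by omega)⟩
    · intro j hj j' _ hjj
      simp only [Finset.coe_Ioc, Set.mem_Ioc] at hj
      have hj0 : f (a + 1, j) ≠ 0 := by
        refine H.ne_zero_of_between (c := (a + 1, c)) (d := (a + 1, b)) (Or.inl (by omega))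
          hr.2.1 ⟨le_rfl, by simp only; omega⟩ ⟨le_rfl, by simp only; omega⟩ (by simp)
      exact congrArg Prod.snd (H.tab.inj _ _ hj0 hjj)
  have hB : s a ≤ b - c - 1 := by
    rw [← P.card x a, ← Nat.card_Ioo]
    have hex : ∀ v ∈ (Finset.Ioc x (x + m)).filter (fun v => ρ v = a), ∃ j, f (a, j) = v := by
      intro v hv
      simp only [Finset.mem_filter, Finset.mem_Ioc] at hv
      obtain ⟨j, hj⟩ := A v (by omega) (by omega)
      rw [hv.2] at hj
      exact ⟨j, hj⟩
    choose! col hcol using hex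
    refine Finset.card_le_card_of_injOn col ?_ ?_
    · intro v hv
      have h1 := hcol v hv
      simp only [Finset.coe_filter, Finset.mem_Ioc, Set.mem_ofPred_eq] at hv
      simp only [Finset.coe_Ioo, Set.mem_Ioo]
      have hne : v ≠ x + m := by
        rintro rfl
        omega
      constructor
      · by_contra h2
        have := H.tab.mono (a, col v) (a + 1, c) ⟨by simp, by simp only; omega⟩ (by omega)
          (by omega)
        omega
      · by_contra h2
        have := hr.2.2 (a, col v) ⟨le_rfl, by simp only; omega⟩ (by omega)
        omega
    · intro v hv v' hv' hvv
      rw [← hcol v hv, ← hcol v' hv', hvv]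
  have := P.anti (Nat.le_succ a)
  simp only [Nat.succ_eq_add_one] at this
  omega

theorem RowsAgree.moveInto (A : RowsAgree N B ρ f) (H : IsHoled N M f h) (hr : IsNext f h r)
    (hB : r.1 = h.1 ∨ f r ≤ B) : RowsAgree N B ρ (moveInto f h r) := by
  intro x hx hxN
  obtain ⟨j, hj⟩ := A x hx hxN
  have h1 := apply_moveInto_ite (c := (ρ x, j)) H.apply_hole (by omega) hr.ne
  split_ifs at h1 with h2
  · have h3 : h.1 = ρ x := by
      have h4 := congrArg Prod.fst h2
      simp only at h4
      rcases hB with hB | hB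
      · omega
      · rw [← h2] at hB
        omega
    exact ⟨h.2, by rw [← h3]; exact h1.trans hj⟩
  · exact ⟨j, h1.trans hj⟩

/-- Every step of a slide to a lower row destroys the agreement in at most one period. -/
theorem IsHoled.rowsAgree_slide (P : IsBalanced m ρ s) (R : ℕ) : ∀ (n : ℕ) {f : ℕ × ℕ → ℕ}
    {h : ℕ × ℕ}, IsHoled N M f h → (∀ c, f c ≠ 0 → c.1 ≤ R) → h.1 ≤ R →
    RowsAgree N (B + h.1 * m) ρ f →
    RowsAgree N (B + R * m) ρ (slide n f h) ∧ ∀ c, slide n f h c ≠ 0 → c.1 ≤ R := by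
  intro n
  induction n with
  | zero =>
    intro f h _ hR hh A
    exact ⟨A.mono (by gcongr), hR⟩
  | succ n ih =>
    intro f h H hR hh A
    by_cases hz : ∀ d, h ≤ d → f d = 0
    · rw [slide_eq_self hz]
      exact ⟨A.mono (by gcongr), hR⟩
    · push Not at hz
      obtain ⟨r, hr⟩ := H.exists_isNext hz
      rw [H.slide_succ hr]
      refine ih (H.moveInto_isHoled hr) ?_ (hR r hr.2.1) ?_
      · intro c hc
        rw [moveInto_apply] at hc
        split_ifs at hc with h1 h2
        · exact absurd rfl hc
        · rw [h2]; exact hh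
        · exact hR c hc
      · have hle : B + h.1 * m ≤ B + r.1 * m := by
          have := hr.le.1
          gcongr
        refine (A.mono hle).moveInto H hr ?_
        rcases hr.1 with rfl | rfl
        · exact Or.inl rfl
        · right
          have := H.le_of_isNext_below hr P A
          simp only
          rw [Nat.add_mul]
          omega

theorem rowsAgree_foldl_slide (P : IsBalanced m ρ s) (R : ℕ) : ∀ (l : List (ℕ × ℕ)) {B : ℕ}
    {f : ℕ × ℕ → ℕ}, IsRemovalOrder l → IsSkewTableau N {c | c ∈ l} f →
    (∀ c, f c ≠ 0 → c.1 ≤ R) → (∀ c ∈ l, c.1 ≤ R) → RowsAgree N B ρ f →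
    RowsAgree N (B + l.length * (R * m)) ρ (l.foldl (slide N) f) := by
  intro l
  induction l with
  | nil => intro B f _ _ _ _ A; simpa using A
  | cons c l ih =>
    intro B f hl F hR hlR A
    have H := hl.isHoled F
    have h1 := H.rowsAgree_slide P R N hR (hlR c (by simp)) (A.mono (Nat.le_add_right B _))
    have h2 := ih hl.tail (H.slide_isSkewTableau fun d _ hd => by omega) h1.2
      (fun d hd => hlR d (List.mem_cons_of_mem _ hd)) h1.1
    refine h2.mono ?_
    rw [List.length_cons, Nat.add_mul]
    omega

end Tail

/-! ### The tableau made of copies of a standard skew tableau -/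

section Shape

variable {lam mu : YoungDiagram}

theorem mem_skewCells_iff {c : ℕ × ℕ} :
    c ∈ skewCells lam mu ↔ mu.rowLen c.1 ≤ c.2 ∧ c.2 < lam.rowLen c.1 := by
  obtain ⟨i, j⟩ := c
  rw [skewCells, Finset.mem_sdiff, YoungDiagram.mem_cells, YoungDiagram.mem_cells,
    YoungDiagram.mem_iff_lt_rowLen, YoungDiagram.mem_iff_lt_rowLen]
  simp only
  omega

theorem lt_rowSize_iff {i t : ℕ} :
    t < rowSize lam mu i ↔ (i, mu.rowLen i + t) ∈ skewCells lam mu := by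
  rw [mem_skewCells_iff, rowSize]
  simp only
  omega

end Shape

namespace StandardSkewTableau

variable {lam mu : YoungDiagram} (S : StandardSkewTableau lam mu)

theorem entry_mem {c : ℕ × ℕ} (hc : c ∈ skewCells lam mu) :
    1 ≤ S.entry c ∧ S.entry c ≤ (skewCells lam mu).card :=
  S.standard.mapsTo hc

theorem mem_of_entry_ne_zero {c : ℕ × ℕ} (hc : S.entry c ≠ 0) : c ∈ skewCells lam mu := by
  by_contra h
  exact hc (S.zeros c h)

theorem entry_mono {c d : ℕ × ℕ} (hc : c ∈ skewCells lam mu) (hd : d ∈ skewCells lam mu)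
    (hcd : c ≤ d) : S.entry c ≤ S.entry d := by
  obtain ⟨i, j⟩ := c
  obtain ⟨i', j'⟩ := d
  obtain ⟨h1, h2⟩ := hcd
  have hc' := mem_skewCells_iff.1 hc
  have hd' := mem_skewCells_iff.1 hd
  simp only at h1 h2 hc' hd'
  have h3 := mu.rowLen_anti i i' h1
  have he : (i', j) ∈ skewCells lam mu :=
    mem_skewCells_iff.2 ⟨by simp only; omega, by simp only; omega⟩
  have h4 : S.entry (i, j) ≤ S.entry (i', j) := by
    rcases h1.eq_or_lt with rfl | h1
    · exact le_rfl
    · exact (S.col_strict i i' j hc he h1).le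
  have h5 : S.entry (i', j) ≤ S.entry (i', j') := by
    rcases h2.eq_or_lt with rfl | h2
    · exact le_rfl
    · exact S.row_weak i' j j' he hd h2
  exact h4.trans h5

/-- The entry in the `q`-th copy of the `t`-th cell of row `i`. -/
theorem attachCopies_apply {k i q t : ℕ} (ht : t < rowSize lam mu i) (hq : q < k) :
    attachCopies lam mu S.entry k (i, mu.rowLen i + (q * rowSize lam mu i + t)) =
      S.entry (i, mu.rowLen i + t) + q * (skewCells lam mu).card := by
  have h1 : q * rowSize lam mu i + t < k * rowSize lam mu i := by
    calc q * rowSize lam mu i + t < (q + 1) * rowSize lam mu i := by rw [Nat.add_mul]; omega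
      _ ≤ k * rowSize lam mu i := Nat.mul_le_mul_right _ hq
  have h2 : (q * rowSize lam mu i + t) % rowSize lam mu i = t := by
    rw [Nat.mul_comm, Nat.mul_add_mod, Nat.mod_eq_of_lt ht]
  have h3 : (q * rowSize lam mu i + t) / rowSize lam mu i = q := by
    rw [Nat.mul_comm, Nat.mul_add_div (by omega), Nat.div_eq_of_lt ht, Nat.add_zero]
  rw [attachCopies, if_pos (by simp only; omega)]
  simp only [Nat.add_sub_cancel_left, h2, h3]

theorem exists_copy {k : ℕ} {c : ℕ × ℕ}
    (hc : mu.rowLen c.1 ≤ c.2 ∧ c.2 < mu.rowLen c.1 + k * rowSize lam mu c.1) :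
    ∃ i q t, t < rowSize lam mu i ∧ q < k ∧ c = (i, mu.rowLen i + (q * rowSize lam mu i + t)) := by
  obtain ⟨i, j⟩ := c
  simp only at hc
  have hpos : 0 < rowSize lam mu i := by
    rcases Nat.eq_zero_or_pos (rowSize lam mu i) with h | h
    · rw [h] at hc
      omega
    · exact h
  refine ⟨i, (j - mu.rowLen i) / rowSize lam mu i, (j - mu.rowLen i) % rowSize lam mu i,
    Nat.mod_lt _ hpos, ?_, ?_⟩
  · rw [Nat.div_lt_iff_lt_mul hpos]
    omega
  · rw [Nat.mul_comm, Nat.div_add_mod, Nat.add_sub_cancel' hc.1]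

theorem attachCopies_ne_zero_iff {k : ℕ} {c : ℕ × ℕ} :
    attachCopies lam mu S.entry k c ≠ 0 ↔
      mu.rowLen c.1 ≤ c.2 ∧ c.2 < mu.rowLen c.1 + k * rowSize lam mu c.1 := by
  constructor
  · intro hc
    by_contra h
    exact hc (by rw [attachCopies, if_neg h])
  · intro hc
    obtain ⟨i, q, t, ht, hq, rfl⟩ := exists_copy hc
    rw [S.attachCopies_apply ht hq]
    have := S.entry_mem (lt_rowSize_iff.1 ht)
    omega

/-- `S^(k)` is a skew tableau. -/
theorem isSkewTableau_attachCopies (hrows : Antitone (rowSize lam mu)) (k : ℕ) :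
    IsSkewTableau (k * (skewCells lam mu).card) {c | c ∈ slideStarts mu}
      (attachCopies lam mu S.entry k) := by
  have hshape : ∀ c, (c ∈ {c | c ∈ slideStarts mu} ∨ attachCopies lam mu S.entry k c ≠ 0) ↔
      c.2 < mu.rowLen c.1 + k * rowSize lam mu c.1 := by
    intro c
    rw [attachCopies_ne_zero_iff, Set.mem_ofPred_eq, mem_slideStarts]
    omega
  refine ⟨?_, ?_, ?_, ?_, ?_⟩
  · intro c d hcd
    rw [hshape, hshape]
    intro hd
    have h1 := mu.rowLen_anti _ _ hcd.1
    have h2 := Nat.mul_le_mul_left k (hrows hcd.1)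
    have h3 := hcd.2
    omega
  · intro c hc hc'
    rw [attachCopies_ne_zero_iff] at hc
    rw [Set.mem_ofPred_eq, mem_slideStarts] at hc'
    omega
  · intro c d hcd hc hd
    obtain ⟨i, q, t, ht, hq, rfl⟩ := exists_copy (S.attachCopies_ne_zero_iff.1 hc)
    obtain ⟨i', q', t', ht', hq', rfl⟩ := exists_copy (S.attachCopies_ne_zero_iff.1 hd)
    rw [S.attachCopies_apply ht hq, S.attachCopies_apply ht' hq']
    obtain ⟨h1, h2⟩ := hcd
    simp only at h1 h2
    have hc1 := lt_rowSize_iff.1 ht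
    have hd1 := lt_rowSize_iff.1 ht'
    have e1 := S.entry_mem hc1
    have e2 := S.entry_mem hd1
    have h3 := mu.rowLen_anti i i' h1
    have h4 := hrows h1
    have h5 := Nat.mul_le_mul_left q h4
    rcases lt_trichotomy q q' with h6 | rfl | h6
    · have h7 := Nat.mul_le_mul_right (skewCells lam mu).card h6
      rw [Nat.succ_mul] at h7
      omega
    · have := S.entry_mono hc1 hd1 ⟨h1, by simp only; omega⟩
      omega
    · have h7 := Nat.mul_le_mul_right (rowSize lam mu i') h6
      rw [Nat.succ_mul] at h7
      omega
  · intro c d hc hcd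
    have hd : attachCopies lam mu S.entry k d ≠ 0 := hcd ▸ hc
    obtain ⟨i, q, t, ht, hq, rfl⟩ := exists_copy (S.attachCopies_ne_zero_iff.1 hc)
    obtain ⟨i', q', t', ht', hq', rfl⟩ := exists_copy (S.attachCopies_ne_zero_iff.1 hd)
    rw [S.attachCopies_apply ht hq, S.attachCopies_apply ht' hq'] at hcd
    have hc1 := lt_rowSize_iff.1 ht
    have hd1 := lt_rowSize_iff.1 ht'
    have e1 := S.entry_mem hc1
    have e2 := S.entry_mem hd1
    rcases lt_trichotomy q q' with h6 | rfl | h6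
    · have h7 := Nat.mul_le_mul_right (skewCells lam mu).card h6
      rw [Nat.succ_mul] at h7
      omega
    · have h8 := S.standard.injOn hc1 hd1 (by omega)
      simp only [Prod.mk.injEq] at h8
      obtain ⟨rfl, h9⟩ := h8
      rw [Nat.add_left_cancel h9]
    · have h7 := Nat.mul_le_mul_right (skewCells lam mu).card h6
      rw [Nat.succ_mul] at h7
      omega
  · intro c
    by_cases hc : attachCopies lam mu S.entry k c = 0
    · omega
    · obtain ⟨i, q, t, ht, hq, rfl⟩ := exists_copy (S.attachCopies_ne_zero_iff.1 hc)
      rw [S.attachCopies_apply ht hq]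
      have e1 := S.entry_mem (lt_rowSize_iff.1 ht)
      have h7 := Nat.mul_le_mul_right (skewCells lam mu).card hq
      rw [Nat.succ_mul] at h7
      omega

/-- The cell of the entry `v`. -/
noncomputable def cellOf (v : ℕ) : ℕ × ℕ :=
  Function.invFunOn S.entry (skewCells lam mu : Set (ℕ × ℕ)) v

theorem cellOf_spec {v : ℕ} (h1 : 1 ≤ v) (h2 : v ≤ (skewCells lam mu).card) :
    S.cellOf v ∈ skewCells lam mu ∧ S.entry (S.cellOf v) = v := by
  have hv : v ∈ S.entry '' (skewCells lam mu : Set (ℕ × ℕ)) := S.standard.surjOn ⟨h1, h2⟩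
  exact ⟨Function.invFunOn_mem hv, Function.invFunOn_eq hv⟩

theorem cellOf_entry {c : ℕ × ℕ} (hc : c ∈ skewCells lam mu) : S.cellOf (S.entry c) = c := by
  have h1 := S.entry_mem hc
  have h2 := S.cellOf_spec h1.1 h1.2
  exact S.standard.injOn h2.1 hc h2.2

/-- The row of the entry `x` in `S^(k)`, for all large `k`: the row of the entry of `S` that is
congruent to `x` modulo the size of `S`. -/
noncomputable def rowWord (x : ℕ) : ℕ :=
  (S.cellOf ((x + ((skewCells lam mu).card - 1)) % (skewCells lam mu).card + 1)).1

theorem rowWord_add_mul {v q : ℕ} (h1 : 1 ≤ v) (h2 : v ≤ (skewCells lam mu).card) :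
    S.rowWord (v + q * (skewCells lam mu).card) = (S.cellOf v).1 := by
  have h3 : v + q * (skewCells lam mu).card + ((skewCells lam mu).card - 1) =
      (v - 1) + (skewCells lam mu).card * (q + 1) := by
    rw [Nat.mul_add, Nat.mul_comm q]
    omega
  rw [rowWord, h3, Nat.add_mul_mod_self_left, Nat.mod_eq_of_lt (by omega), Nat.sub_add_cancel h1]

theorem isBalanced_rowWord (hrows : Antitone (rowSize lam mu))
    (hm : 0 < (skewCells lam mu).card) :
    IsBalanced (skewCells lam mu).card S.rowWord (rowSize lam mu) := by
  have hper : ∀ x, S.rowWord (x + (skewCells lam mu).card) = S.rowWord x := by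
    intro x
    rw [rowWord, rowWord, Nat.add_right_comm, Nat.add_mod_right]
  have hcount : ∀ y i, ((Finset.Ioc y (y + (skewCells lam mu).card)).filter
      fun x => S.rowWord x = i).card =
      Nat.count (fun x => S.rowWord x = i) (skewCells lam mu).card := by
    intro y i
    rw [← Nat.filter_Ico_card_eq_of_periodic (y + 1) (skewCells lam mu).card
      (fun x => S.rowWord x = i) fun x => by simp only [hper]]
    congr 2
    ext x
    simp only [Finset.mem_Ioc, Finset.mem_Ico]
    omega
  refine ⟨hm, hper, fun y i => ?_, hrows⟩
  rw [hcount y i, ← hcount 0 i]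
  -- one period consists of the entries of `S`
  symm
  rw [← Finset.card_range (rowSize lam mu i)]
  refine Finset.card_nbij (fun t => S.entry (i, mu.rowLen i + t)) ?_ ?_ ?_
  · intro t ht
    have hc := lt_rowSize_iff.1 (Finset.mem_range.1 ht)
    have h1 := S.entry_mem hc
    have h2 := S.rowWord_add_mul (q := 0) h1.1 h1.2
    rw [S.cellOf_entry hc, Nat.zero_mul, Nat.add_zero] at h2
    simp only [Finset.coe_filter, Finset.mem_Ioc, Set.mem_ofPred_eq]
    exact ⟨by omega, h2⟩
  · intro t ht t' ht' htt
    have hc := lt_rowSize_iff.1 (Finset.mem_range.1 (Finset.mem_coe.1 ht))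
    have hc' := lt_rowSize_iff.1 (Finset.mem_range.1 (Finset.mem_coe.1 ht'))
    have := congrArg Prod.snd (S.standard.injOn hc hc' htt)
    simp only at this
    omega
  · intro v hv
    simp only [Finset.coe_filter, Finset.mem_Ioc, Set.mem_ofPred_eq] at hv
    have h2 := S.rowWord_add_mul (v := v) (q := 0) (by omega) (by omega)
    rw [Nat.zero_mul, Nat.add_zero, hv.2] at h2
    obtain ⟨h3, h4⟩ := S.cellOf_spec (v := v) (by omega) (by omega)
    have h5 := mem_skewCells_iff.1 h3
    have h6 : (i, mu.rowLen i + ((S.cellOf v).2 - mu.rowLen i)) = S.cellOf v := by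
      rw [h2, Nat.add_sub_cancel' h5.1]
    refine ⟨(S.cellOf v).2 - mu.rowLen i, ?_, ?_⟩
    · rw [Finset.mem_coe, Finset.mem_range, lt_rowSize_iff, h6]
      exact h3
    · simp only [h6, h4]

theorem rowsAgree_attachCopies (k : ℕ) :
    RowsAgree (k * (skewCells lam mu).card) 0 S.rowWord (attachCopies lam mu S.entry k) := by
  intro x hx hxk
  set m := (skewCells lam mu).card with hm
  have hmpos : 0 < m := by
    rcases Nat.eq_zero_or_pos m with h | h
    · rw [h] at hxk
      omega
    · exact h
  obtain ⟨v, q, hv1, hv2, hq, rfl⟩ : ∃ v q, 1 ≤ v ∧ v ≤ m ∧ q < k ∧ x = v + q * m := by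
    refine ⟨(x - 1) % m + 1, (x - 1) / m, by omega, Nat.mod_lt _ hmpos, ?_, ?_⟩
    · rw [Nat.div_lt_iff_lt_mul hmpos]
      omega
    · have := Nat.mod_add_div (x - 1) m
      rw [Nat.mul_comm] at this
      omega
  rw [S.rowWord_add_mul hv1 hv2]
  obtain ⟨h3, h4⟩ := S.cellOf_spec hv1 hv2
  have h5 := mem_skewCells_iff.1 h3
  have h6 : ((S.cellOf v).1, mu.rowLen (S.cellOf v).1 +
      ((S.cellOf v).2 - mu.rowLen (S.cellOf v).1)) = S.cellOf v := by
    rw [Nat.add_sub_cancel' h5.1]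
  refine ⟨_, (S.attachCopies_apply (t := (S.cellOf v).2 - mu.rowLen (S.cellOf v).1) ?_ hq).trans ?_⟩
  · rw [lt_rowSize_iff, h6]
    exact h3
  · rw [h6, h4]

theorem exists_stabilizesAt (hmu : mu ≤ lam) (hrows : Antitone (rowSize lam mu)) :
    ∃ k, S.StabilizesAt k := by
  rcases Nat.eq_zero_or_pos (skewCells lam mu).card with hm | hm
  · refine ⟨1, le_rfl, fun x hx => ?_⟩
    rw [hm] at hx
    obtain ⟨h1, h2⟩ := hx
    omega
  · have hrow : ∀ c ∈ lam, c.1 ≤ lam.colLen 0 := by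
      rintro ⟨i, j⟩ hc
      have := lam.up_left_mem le_rfl (Nat.zero_le j) hc
      rw [YoungDiagram.mem_iff_lt_colLen] at this
      exact this.le
    have P := S.isBalanced_rowWord hrows hm
    set B := (slideStarts mu).length * lam.colLen 0 with hB
    refine ⟨B + 1, by omega, fun x hx i => ?_⟩
    rw [Nat.add_sub_cancel] at hx
    obtain ⟨hx1, hx2⟩ := hx
    have F := S.isSkewTableau_attachCopies hrows (B + 1)
    have A := S.rowsAgree_attachCopies (B + 1)
    have A' := rowsAgree_foldl_slide P (lam.colLen 0) (slideStarts mu)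
      (isRemovalOrder_slideStarts mu) F ?_ ?_ A
    · rw [rectify, inRow_iff_of_rowsAgree A' (F.foldl_slide (isRemovalOrder_slideStarts mu)) _ hx2,
        inRow_iff_of_rowsAgree A F (by omega) hx2]
      rw [← Nat.mul_assoc, ← hB]
      omega
    · intro c hc
      obtain ⟨i, q, t, ht, hq, rfl⟩ := exists_copy (S.attachCopies_ne_zero_iff.1 hc)
      have h1 := lt_rowSize_iff.1 ht
      rw [skewCells, Finset.mem_sdiff, YoungDiagram.mem_cells] at h1
      exact hrow (i, mu.rowLen i + t) h1.1
    · rintro ⟨i, j⟩ hc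
      rw [mem_slideStarts] at hc
      exact hrow _ (hmu (YoungDiagram.mem_iff_lt_rowLen.2 hc))

end StandardSkewTableau

/-! ### Dual equivalence and stabilization -/

theorem inRow_swap_iff {f g : ℕ × ℕ → ℕ} {p : ℕ}
    (hg : ∀ c, g c = Equiv.swap p (p + 1) (f c)) (x i : ℕ) :
    InRow g x i ↔ InRow f (Equiv.swap p (p + 1) x) i := by
  simp only [InRow, hg]
  exact exists_congr fun j => by rw [← Equiv.swap_apply_eq_iff]

theorem inRow_unique {N : ℕ} {M : Set (ℕ × ℕ)} {f : ℕ × ℕ → ℕ} (F : IsSkewTableau N M f)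
    {x i i' : ℕ} (hx : x ≠ 0) (h : InRow f x i) (h' : InRow f x i') : i = i' := by
  obtain ⟨j, hj⟩ := h
  obtain ⟨j', hj'⟩ := h'
  exact congrArg Prod.fst (F.inj (i, j) (i', j') (by omega) (by omega))

/-- An elementary dual equivalence move exchanges `p + 1` and `p + 2`, or `p` and `p + 1`; the
rows of `p`, `p + 1` and `p + 2` tell which. -/
theorem exists_rows_of_isDualMove {f g : ℕ × ℕ → ℕ} {p : ℕ}
    (D : IsDualMove p f g ∨ IsDualMove p g f) :
    p ≠ 0 ∧ ∃ i₀ i₁ i₂, InRow f p i₀ ∧ InRow f (p + 1) i₁ ∧ InRow f (p + 2) i₂ ∧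
      (((i₂ ≤ i₀ ∧ i₀ < i₁ ∨ i₁ ≤ i₀ ∧ i₀ < i₂) ∧
          ∀ c, g c = Equiv.swap (p + 1) (p + 1 + 1) (f c)) ∨
        ((i₁ < i₂ ∧ i₂ ≤ i₀ ∨ i₀ < i₂ ∧ i₂ ≤ i₁) ∧ ∀ c, g c = Equiv.swap p (p + 1) (f c))) := by
  rcases D with ⟨hp, c₀, c₁, c₂, h0, h1, h2, ⟨h3, h4, h5⟩ | ⟨h3, h4, h5⟩⟩ |
    ⟨hp, c₀, c₁, c₂, h0, h1, h2, ⟨h3, h4, h5⟩ | ⟨h3, h4, h5⟩⟩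
  · exact ⟨hp, c₀.1, c₁.1, c₂.1, ⟨_, h0⟩, ⟨_, h1⟩, ⟨_, h2⟩, Or.inl ⟨Or.inl ⟨h3, h4⟩, h5⟩⟩
  · exact ⟨hp, c₀.1, c₁.1, c₂.1, ⟨_, h0⟩, ⟨_, h1⟩, ⟨_, h2⟩, Or.inr ⟨Or.inl ⟨h3, h4⟩, h5⟩⟩
  · refine ⟨hp, c₀.1, c₂.1, c₁.1, ⟨c₀.2, ?_⟩, ⟨c₂.2, ?_⟩, ⟨c₁.2, ?_⟩,
      Or.inl ⟨Or.inr ⟨h3, h4⟩, fun c => ?_⟩⟩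
    · rw [h5, Prod.mk.eta, h0, Equiv.swap_apply_of_ne_of_ne] <;> omega
    · rw [h5, Prod.mk.eta, h2, Equiv.swap_apply_right]
    · rw [h5, Prod.mk.eta, h1, Equiv.swap_apply_left]
    · rw [h5, Equiv.swap_apply_self]
  · refine ⟨hp, c₁.1, c₀.1, c₂.1, ⟨c₁.2, ?_⟩, ⟨c₀.2, ?_⟩, ⟨c₂.2, ?_⟩,
      Or.inr ⟨Or.inr ⟨h3, h4⟩, fun c => ?_⟩⟩
    · rw [h5, Prod.mk.eta, h1, Equiv.swap_apply_right]
    · rw [h5, Prod.mk.eta, h0, Equiv.swap_apply_left]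
    · rw [h5, Prod.mk.eta, h2, Equiv.swap_apply_of_ne_of_ne] <;> omega
    · rw [h5, Equiv.swap_apply_self]

/-- If the entries in `X` are in the same rows of two fillings, one of them a skew tableau, then
they are so after an elementary dual equivalence move on entries in `X`, and after one on entries
not in `X`. -/
theorem forall_inRow_iff_of_isDualMove {N p : ℕ} {M : Set (ℕ × ℕ)} {f g f' g' : ℕ × ℕ → ℕ}
    (F : IsSkewTableau N M f) (D : IsDualMove p f g ∨ IsDualMove p g f)
    (D' : IsDualMove p f' g' ∨ IsDualMove p g' f') {X : Set ℕ}
    (hX : (p ∈ X ∧ p + 1 ∈ X ∧ p + 2 ∈ X) ∨ (p ∉ X ∧ p + 1 ∉ X ∧ p + 2 ∉ X))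
    (h : ∀ x ∈ X, ∀ i, InRow f' x i ↔ InRow f x i) :
    ∀ x ∈ X, ∀ i, InRow g' x i ↔ InRow g x i := by
  obtain ⟨hp, i₀, i₁, i₂, h0, h1, h2, E⟩ := exists_rows_of_isDualMove D
  obtain ⟨-, i₀', i₁', i₂', h0', h1', h2', E'⟩ := exists_rows_of_isDualMove D'
  intro x hx i
  rcases hX with ⟨hX0, hX1, hX2⟩ | ⟨hX0, hX1, hX2⟩
  · have e0 := inRow_unique F hp h0 ((h _ hX0 _).1 h0')
    have e1 := inRow_unique F (by omega) h1 ((h _ hX1 _).1 h1')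
    have e2 := inRow_unique F (by omega) h2 ((h _ hX2 _).1 h2')
    subst e0 e1 e2
    rcases E with ⟨E, hg⟩ | ⟨E, hg⟩ <;> rcases E' with ⟨E', hg'⟩ | ⟨E', hg'⟩
    · rw [inRow_swap_iff hg, inRow_swap_iff hg']
      refine h _ ?_ i
      rw [swap_succ_apply]
      split_ifs
      · exact hX2
      · exact hX1
      · exact hx
    · omega
    · omega
    · rw [inRow_swap_iff hg, inRow_swap_iff hg']
      refine h _ ?_ i
      rw [swap_succ_apply]
      split_ifs
      · exact hX1
      · exact hX0
      · exact hx
  · have n0 : x ≠ p := fun e => hX0 (e ▸ hx)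
    have n1 : x ≠ p + 1 := fun e => hX1 (e ▸ hx)
    have n2 : x ≠ p + 1 + 1 := fun e => hX2 (e ▸ hx)
    have key : InRow g x i ↔ InRow f x i := by
      rcases E with ⟨-, hg⟩ | ⟨-, hg⟩
      · rw [inRow_swap_iff hg, Equiv.swap_apply_of_ne_of_ne n1 n2]
      · rw [inRow_swap_iff hg, Equiv.swap_apply_of_ne_of_ne n0 n1]
    have key' : InRow g' x i ↔ InRow f' x i := by
      rcases E' with ⟨-, hg⟩ | ⟨-, hg⟩
      · rw [inRow_swap_iff hg, Equiv.swap_apply_of_ne_of_ne n1 n2]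
      · rw [inRow_swap_iff hg, Equiv.swap_apply_of_ne_of_ne n0 n1]
    rw [key, key', h x hx i]

namespace StandardSkewTableau

variable {lam mu : YoungDiagram} {S T : StandardSkewTableau lam mu}

/-- The filling with the first `t` copies those of `T` and the other ones those of `S`. -/
def mixedCopies (S T : StandardSkewTableau lam mu) (k t : ℕ) : ℕ × ℕ → ℕ := fun c =>
  if attachCopies lam mu S.entry k c ≤ t * (skewCells lam mu).card then
    attachCopies lam mu T.entry k c
  else attachCopies lam mu S.entry k c

theorem mixedCopies_of_not_mem {k t : ℕ} {c : ℕ × ℕ}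
    (hc : ¬ (mu.rowLen c.1 ≤ c.2 ∧ c.2 < mu.rowLen c.1 + k * rowSize lam mu c.1)) :
    mixedCopies S T k t c = 0 := by
  rw [mixedCopies, attachCopies, attachCopies, if_neg hc, if_neg hc, ite_self]

theorem mixedCopies_apply {k t i q s : ℕ} (hs : s < rowSize lam mu i) (hq : q < k) :
    mixedCopies S T k t (i, mu.rowLen i + (q * rowSize lam mu i + s)) =
      (if q < t then T.entry (i, mu.rowLen i + s) else S.entry (i, mu.rowLen i + s)) +
        q * (skewCells lam mu).card := by
  rw [mixedCopies, S.attachCopies_apply hs hq, T.attachCopies_apply hs hq]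
  have h1 := S.entry_mem (lt_rowSize_iff.1 hs)
  by_cases h2 : q < t
  · have h3 := Nat.mul_le_mul_right (skewCells lam mu).card h2
    rw [Nat.succ_mul] at h3
    rw [if_pos h2, if_pos (by omega)]
  · have h3 := Nat.mul_le_mul_right (skewCells lam mu).card (not_lt.1 h2)
    rw [if_neg h2, if_neg (by omega)]

theorem mixedCopies_zero (k : ℕ) : mixedCopies S T k 0 = attachCopies lam mu S.entry k := by
  funext c
  by_cases hc : mu.rowLen c.1 ≤ c.2 ∧ c.2 < mu.rowLen c.1 + k * rowSize lam mu c.1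
  · obtain ⟨i, q, s, hs, hq, rfl⟩ := exists_copy hc
    rw [mixedCopies_apply hs hq, if_neg (Nat.not_lt_zero q), S.attachCopies_apply hs hq]
  · rw [mixedCopies_of_not_mem hc, attachCopies, if_neg hc]

theorem mixedCopies_self (k : ℕ) : mixedCopies S T k k = attachCopies lam mu T.entry k := by
  funext c
  by_cases hc : mu.rowLen c.1 ≤ c.2 ∧ c.2 < mu.rowLen c.1 + k * rowSize lam mu c.1
  · obtain ⟨i, q, s, hs, hq, rfl⟩ := exists_copy hc
    rw [mixedCopies_apply hs hq, if_pos hq, T.attachCopies_apply hs hq]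
  · rw [mixedCopies_of_not_mem hc, attachCopies, if_neg hc]

theorem mixedCopies_succ {p : ℕ} (hp : p ≠ 0) (hpm : p + 1 ≤ (skewCells lam mu).card)
    (hT : ∀ c, T.entry c = Equiv.swap p (p + 1) (S.entry c)) {k t : ℕ} (c : ℕ × ℕ) :
    mixedCopies S T k (t + 1) c =
      Equiv.swap (p + t * (skewCells lam mu).card) (p + t * (skewCells lam mu).card + 1)
        (mixedCopies S T k t c) := by
  by_cases hc : mu.rowLen c.1 ≤ c.2 ∧ c.2 < mu.rowLen c.1 + k * rowSize lam mu c.1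
  · obtain ⟨i, q, s, hs, hq, rfl⟩ := exists_copy hc
    rw [mixedCopies_apply hs hq, mixedCopies_apply hs hq]
    have hmem := lt_rowSize_iff.1 hs
    have h1 := S.entry_mem hmem
    have h2 := T.entry_mem hmem
    rcases lt_trichotomy q t with h3 | rfl | h3
    · have h4 := Nat.mul_le_mul_right (skewCells lam mu).card h3
      rw [Nat.succ_mul] at h4
      rw [if_pos h3, if_pos (by omega), Equiv.swap_apply_of_ne_of_ne] <;> omega
    · rw [if_neg (lt_irrefl q), if_pos (Nat.lt_succ_self q), hT, swap_succ_apply, swap_succ_apply]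
      split_ifs <;> omega
    · have h4 := Nat.mul_le_mul_right (skewCells lam mu).card h3
      rw [Nat.succ_mul] at h4
      rw [if_neg (by omega), if_neg (by omega), Equiv.swap_apply_of_ne_of_ne] <;> omega
  · rw [mixedCopies_of_not_mem hc, mixedCopies_of_not_mem hc, Equiv.swap_apply_of_ne_of_ne] <;>
      omega

theorem exists_mixedCopies_eq {k t : ℕ} (ht : t < k) {c : ℕ × ℕ} (hc : c ∈ skewCells lam mu) :
    ∃ d : ℕ × ℕ, d.1 = c.1 ∧
      mixedCopies S T k t d = S.entry c + t * (skewCells lam mu).card := by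
  obtain ⟨i, j⟩ := c
  have h1 : mu.rowLen i ≤ j := (mem_skewCells_iff.1 hc).1
  obtain ⟨s, rfl⟩ := Nat.exists_eq_add_of_le h1
  exact ⟨(i, mu.rowLen i + (t * rowSize lam mu i + s)), rfl, by
    rw [mixedCopies_apply (lt_rowSize_iff.2 hc) ht, if_neg (lt_irrefl t)]⟩

/-- An elementary dual equivalence move on `S` is one on every copy of `S`. -/
theorem isDualMove_mixedCopies {p : ℕ} (D : IsDualMove p S.entry T.entry) {k t : ℕ} (ht : t < k) :
    IsDualMove (p + t * (skewCells lam mu).card) (mixedCopies S T k t)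
      (mixedCopies S T k (t + 1)) := by
  obtain ⟨hp, c₀, c₁, c₂, h0, h1, h2, D⟩ := D
  have m0 := S.mem_of_entry_ne_zero (c := c₀) (by omega)
  have m1 := S.mem_of_entry_ne_zero (c := c₁) (by omega)
  have m2 := S.mem_of_entry_ne_zero (c := c₂) (by omega)
  have hpm := (S.entry_mem m2).2
  obtain ⟨d₀, r0, e0⟩ := exists_mixedCopies_eq (S := S) (T := T) ht m0
  obtain ⟨d₁, r1, e1⟩ := exists_mixedCopies_eq (S := S) (T := T) ht m1
  obtain ⟨d₂, r2, e2⟩ := exists_mixedCopies_eq (S := S) (T := T) ht m2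
  refine ⟨by omega, d₀, d₁, d₂, by omega, by omega, by omega, ?_⟩
  rw [r0, r1, r2]
  refine D.imp ?_ ?_
  · rintro ⟨h3, h4, h5⟩
    refine ⟨h3, h4, fun c => ?_⟩
    rw [mixedCopies_succ (p := p + 1) (by omega) (by omega) h5]
    congr 2 <;> omega
  · rintro ⟨h3, h4, h5⟩
    exact ⟨h3, h4, fun c => mixedCopies_succ hp (by omega) h5 c⟩

theorem stabilizesAt_iff_of_isDualMove (hrows : Antitone (rowSize lam mu)) {p : ℕ}
    (D : IsDualMove p S.entry T.entry) (k : ℕ) : S.StabilizesAt k ↔ T.StabilizesAt k := by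
  set m := (skewCells lam mu).card with hm
  have hp := D.1
  have hpm : p + 2 ≤ m := by
    obtain ⟨_, _, _, c₂, _, _, h2, _⟩ := D
    have := (S.entry_mem (S.mem_of_entry_ne_zero (c := c₂) (by omega))).2
    omega
  have F : ∀ t ≤ k, IsSkewTableau (k * m) {c | c ∈ slideStarts mu} (mixedCopies S T k t) := by
    intro t
    induction t with
    | zero =>
      intro _
      rw [mixedCopies_zero]
      exact S.isSkewTableau_attachCopies hrows k
    | succ t ih =>
      intro ht
      exact (isDualMove_mixedCopies D ht).isSkewTableau (ih (by omega))
  have hl := isRemovalOrder_slideStarts mu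
  -- the moves on the first `k - 1` copies do not concern the last block of entries
  have step : ∀ t ≤ k, ((∀ x ∈ Set.Icc ((k - 1) * m + 1) (k * m), ∀ i,
      InRow (rectify mu (k * m) (mixedCopies S T k 0)) x i ↔ InRow (mixedCopies S T k 0) x i) ↔
      (∀ x ∈ Set.Icc ((k - 1) * m + 1) (k * m), ∀ i,
      InRow (rectify mu (k * m) (mixedCopies S T k t)) x i ↔ InRow (mixedCopies S T k t) x i)) := by
    intro t
    induction t with
    | zero => exact fun _ => Iff.rfl
    | succ t ih =>
      intro ht
      refine (ih (by omega)).trans ?_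
      have D1 := isDualMove_mixedCopies D (k := k) ht
      have F1 := F t (by omega)
      have F2 := F (t + 1) ht
      have D2 := isDualMove_foldl_slide hl F1 F2 (Or.inl D1)
      have hX : ∀ q, q = p + t * m →
          (q ∈ Set.Icc ((k - 1) * m + 1) (k * m) ∧ q + 1 ∈ Set.Icc ((k - 1) * m + 1) (k * m) ∧
            q + 2 ∈ Set.Icc ((k - 1) * m + 1) (k * m)) ∨
          (q ∉ Set.Icc ((k - 1) * m + 1) (k * m) ∧ q + 1 ∉ Set.Icc ((k - 1) * m + 1) (k * m) ∧
            q + 2 ∉ Set.Icc ((k - 1) * m + 1) (k * m)) := by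
        rintro q rfl
        simp only [Set.mem_Icc]
        by_cases h1 : t + 1 = k
        · subst h1
          rw [Nat.add_sub_cancel, Nat.succ_mul]
          omega
        · have h2 : (t + 1) * m ≤ (k - 1) * m := Nat.mul_le_mul_right m (by omega)
          rw [Nat.succ_mul] at h2
          omega
      exact ⟨forall_inRow_iff_of_isDualMove F1 (Or.inl D1) D2 (hX _ rfl),
        forall_inRow_iff_of_isDualMove F2 (Or.inr D1) D2.symm (hX _ rfl)⟩
  have h := step k le_rfl
  rw [mixedCopies_zero, mixedCopies_self] at h
  exact and_congr_right fun _ => h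

theorem row_lt_of_readsBefore {x : ℕ} {c d : ℕ × ℕ} (hc : S.entry c = x + 1)
    (hd : S.entry d ≤ x) (hd0 : S.entry d ≠ 0) (h : ReadsBefore c d) : d.1 < c.1 := by
  rcases h with h | ⟨h1, h2⟩
  · exact h
  · have := S.entry_mono (S.mem_of_entry_ne_zero (c := c) (by omega)) (S.mem_of_entry_ne_zero hd0)
      ⟨h1.le, h2.le⟩
    omega

theorem row_le_of_readsBefore {c d : ℕ × ℕ} (h : ReadsBefore c d) : d.1 ≤ c.1 := by
  rcases h with h | ⟨h1, h2⟩
  · exact h.le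
  · exact h1.ge

theorem ElementaryMove.exists_isDualMove {i : ℕ} (h : ElementaryMove i S T) :
    ∃ p, IsDualMove p S.entry T.entry ∨ IsDualMove p T.entry S.entry := by
  obtain ⟨a, b, hab, ⟨ca, ha, cb, hb, ci, hi, ea, eb, ei, ho⟩, hT⟩ := h
  have pa := S.entry_mem ha
  have pb := S.entry_mem hb
  have pi := S.entry_mem hi
  have hS : ∀ c, S.entry c = Equiv.swap a i (T.entry c) := fun c => by
    rw [hT, Equiv.swap_apply_self]
  have ta : T.entry ca = i := by rw [hT, ea, Equiv.swap_apply_left]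
  have ti : T.entry ci = a := by rw [hT, ei, Equiv.swap_apply_right]
  have tb : T.entry cb = b := by
    rw [hT, eb, Equiv.swap_apply_of_ne_of_ne] <;> omega
  rcases hab with ⟨rfl, rfl⟩ | ⟨rfl, rfl⟩
  · rw [Equiv.swap_comm] at hT hS
    rcases ho with ⟨h1, h2⟩ | ⟨h1, h2⟩
    · refine ⟨b, Or.inr ⟨by omega, cb, ca, ci, tb, ta, ti, Or.inl
        ⟨row_le_of_readsBefore h2, row_lt_of_readsBefore ea (by omega) (by omega) h1, hS⟩⟩⟩
    · refine ⟨b, Or.inl ⟨by omega, cb, ci, ca, eb, ei, ea, Or.inl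
        ⟨row_le_of_readsBefore h2, row_lt_of_readsBefore ei (by omega) (by omega) h1, hT⟩⟩⟩
  · rcases ho with ⟨h1, h2⟩ | ⟨h1, h2⟩
    · refine ⟨a, Or.inl ⟨by omega, ca, ci, cb, ea, ei, eb, Or.inr
        ⟨row_lt_of_readsBefore eb (by omega) (by omega) h2, row_le_of_readsBefore h1, hT⟩⟩⟩
    · refine ⟨a, Or.inr ⟨by omega, ci, ca, cb, ti, ta, tb, Or.inr
        ⟨row_lt_of_readsBefore eb (by omega) (by omega) h2, row_le_of_readsBefore h1, hS⟩⟩⟩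

theorem DualEquivalent.stabilizesAt_iff (hrows : Antitone (rowSize lam mu))
    (h : S.DualEquivalent T) (k : ℕ) : S.StabilizesAt k ↔ T.StabilizesAt k := by
  induction h with
  | refl => exact Iff.rfl
  | tail _ hUV ih =>
    obtain ⟨i, hi⟩ := hUV
    obtain ⟨p, D | D⟩ := hi.exists_isDualMove
    · exact ih.trans (stabilizesAt_iff_of_isDualMove hrows D k)
    · exact ih.trans (stabilizesAt_iff_of_isDualMove hrows D k).symm

end StandardSkewTableau

theorem mainTheorem7 (lam mu : YoungDiagram) (hmu : mu ≤ lam)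
    (hrows : Antitone (rowSize lam mu))
    (S T : StandardSkewTableau lam mu) (hST : S.DualEquivalent T) :
    (∃ k, S.StabilizesAt k) ∧ (∃ k, T.StabilizesAt k) ∧ S.stab = T.stab := by
  refine ⟨S.exists_stabilizesAt hmu hrows, T.exists_stabilizesAt hmu hrows, ?_⟩
  rw [StandardSkewTableau.stab, StandardSkewTableau.stab]
  congr 1
  ext k
  exact hST.stabilizesAt_iff hrows k
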